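/- Let $d\ge 1$ be an integer and let $p\ge 1$ be real. Let $\mathcal F_d$ be the set of all functions $f:[0,1]^d\to[0,1]$ that are monotonic in each variable, that is, whose restriction to every line segment of $[0,1]^d$ parallel to a coordinate axis is nondecreasing or nonincreasing. Let $\|\cdot\|_p$ be the $L^p$ norm with respect to Lebesgue measure on $[0,1]^d$. For $\varepsilon>0$ let $N(\varepsilon,\mathcal F_d,\|\cdot\|_p)$ be the least $m$ for which there are $f_1,\dots,f_m\in L^p([0,1]^d)$ such that every $f\in\mathcal F_d$ satisfies $\|f-f_k\|_p\le\varepsilon$ for some $k$, and let $N_{[\,]}(\varepsilon,\mathcal F_d,\|\cdot\|_p)$ be the least $m$ for which there are $\underline f_1,\overline f_1,\dots,\underline f_m,\overline f_m\in L^p([0,1]^d)$ with $\|\overline f_k-\underline f_k\|_p\le\varepsilon$ for all $k$ such that every $f\in\mathcal F_d$ satisfies $\underline f_k\le f\le\overline f_k$ pointwise on $[0,1]^d$ for some $k$. Put $\alpha=\max\{d,(d-1)p\}$. Then there are constants $c_1,c_2>0$, depending only on $p$ and $d$, such that for all $0<\varepsilon<1/2$ both numbers are finite and the following holds. If $(d-1)p\ne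 d$, then $$c_1\varepsilon^{-\alpha}\le\log N(\varepsilon,\mathcal F_d,\|\cdot\|_p)\le\log N_{[\,]}(\varepsilon,\mathcal F_d,\|\cdot\|_p)\le c_2\varepsilon^{-\alpha}.$$ If $(d-1)p=d$, then $$c_1\varepsilon^{-d}\le\log N(\varepsilon,\mathcal F_d,\|\cdot\|_p)\le\log N_{[\,]}(\varepsilon,\mathcal F_d,\|\cdot\|_p)\le c_2\varepsilon^{-d}\,(\log 1/\varepsilon)^{1+d/p}.$$ -/

import Mathlib

open MeasureTheory
open scoped ENNReal

/-- The cube `[0,1]^d`, with the product (Lebesgue) measure as `volume`. -/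
abbrev UnitCube (d : ℕ) : Type := Fin d → unitInterval

/-- The functions on `[0,1]^d` with values in `[0,1]` that are monotonic (nondecreasing or
nonincreasing) along every line parallel to a coordinate axis. The line through `x` in direction
`i` is `t ↦ Function.update x i t`. -/
def monotoneClass (d : ℕ) : Set (UnitCube d → ℝ) :=
  {f | (∀ x, 0 ≤ f x ∧ f x ≤ 1) ∧
    ∀ (x : UnitCube d) (i : Fin d),
      Monotone (fun t : unitInterval => f (Function.update x i t)) ∨
        Antitone (fun t : unitInterval => f (Function.update x i t))}

/-- `F` is covered by `m` closed balls of radius `ε` in the `L^p` norm, centred at functions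
in `L^p`. -/
def HasLpCover {d : ℕ} (F : Set (UnitCube d → ℝ)) (p ε : ℝ) (m : ℕ) : Prop :=
  ∃ g : Fin m → UnitCube d → ℝ,
    (∀ k, MemLp (g k) (ENNReal.ofReal p) volume) ∧
    ∀ f ∈ F, ∃ k, eLpNorm (f - g k) (ENNReal.ofReal p) volume ≤ ENNReal.ofReal ε

/-- `F` is covered by `m` brackets `[l k, u k]` of `L^p` size at most `ε`. The order on functions
is the pointwise one, at every point of the cube. -/
def HasLpBracketing {d : ℕ} (F : Set (UnitCube d → ℝ)) (p ε : ℝ) (m : ℕ) : Prop :=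
  ∃ l u : Fin m → UnitCube d → ℝ,
    (∀ k, MemLp (l k) (ENNReal.ofReal p) volume ∧ MemLp (u k) (ENNReal.ofReal p) volume ∧
      eLpNorm (u k - l k) (ENNReal.ofReal p) volume ≤ ENNReal.ofReal ε) ∧
    ∀ f ∈ F, ∃ k, l k ≤ f ∧ f ≤ u k

/-- The covering number `N(ε, F, ‖·‖_p)`; it is `⊤` if there is no finite cover. -/
noncomputable def lpCoveringNumber {d : ℕ} (F : Set (UnitCube d → ℝ)) (p ε : ℝ) : ℕ∞ :=
  ⨅ (m : ℕ) (_ : HasLpCover F p ε m), (m : ℕ∞)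

/-- The bracketing number `N_[](ε, F, ‖·‖_p)`; it is `⊤` if there is no finite bracketing. -/
noncomputable def lpBracketingNumber {d : ℕ} (F : Set (UnitCube d → ℝ)) (p ε : ℝ) : ℕ∞ :=
  ⨅ (m : ℕ) (_ : HasLpBracketing F p ε m), (m : ℕ∞)

/-- The metric entropy `log N(ε, F, ‖·‖_p)`, with `log 0 = ⊥` and `log ⊤ = ⊤`. -/
noncomputable def lpEntropy {d : ℕ} (F : Set (UnitCube d → ℝ)) (p ε : ℝ) : EReal :=
  ENNReal.log (lpCoveringNumber F p ε : ℝ≥0∞)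

/-- The bracketing entropy `log N_[](ε, F, ‖·‖_p)`, with `log 0 = ⊥` and `log ⊤ = ⊤`. -/
noncomputable def lpBracketingEntropy {d : ℕ} (F : Set (UnitCube d → ℝ)) (p ε : ℝ) : EReal :=
  ENNReal.log (lpBracketingNumber F p ε : ℝ≥0∞)

/-! Upper bound. Along every axis-parallel line a function of the class has variation at most 1, so
its variations over the cells of mesh 2⁻ᵏ add up to O(2^{k(d-1)}) (`sum_cellVariation_le`), while
its oscillation on one cell is at most its variation along the edges (`abs_sub_cellCorner_le`). This
suggests an adaptive dyadic partition: split all cells below level n, and later only those whose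
variation exceeds a threshold t_k. Take t_k = 2⁻ᵏ up to level n and t_{n+j} = 2^{βj-n} afterwards.
The thresholds grow, so a poorer approximation is accepted on the few small cells where the function
is rough, and splitting stops once t ≥ 1, after about n/β further levels. By Markov's inequality the
p-th power of the bracket size is O(2^{-np}(1 + Σ_j 2^{(β(p-1)-1)j})) (`rpow_leafWidth_le`).

To count partitions together with rounded values without losing a logarithm, both are coded by a
tree whose labels are increments relative to the parent. A Kraft inequality gives at most e^L trees
of cost L (`LabelledTree.card_cost_le`), and the cost is O(2^{nd}(1 + Σ_j 2^{(d-1-β)j}))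
(`cost_encode_root_le`). If (d-1)p < d, some β between d-1 and 1/(p-1) makes both sums bounded. If
(d-1)p > d, some β between 1/(p-1) and d-1 makes the last terms dominate, and β cancels in the final
exponent. In the critical case β = d-1 gives sums of about n/β equal terms, whence the logarithms.

Lower bound. Raising an arbitrary set of cells of a suitable increasing step function keeps it
increasing, and subsets far apart in Hamming distance give functions far apart in L^p
(`le_lpEntropy_of_cells`). A linear profile with steps of order ε on all cells gives ε^{-d}; a jump
from 0 to 1 across an antidiagonal of cells of mesh of order ε^p gives ε^{-(d-1)p}. Finiteness is
contained in the real upper bounds for the `EReal`-valued entropies. -/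

/-! ### Dyadic grids on the unit interval and on the cube -/

/-- The dyadic point `j / 2^k`, truncated to the unit interval. -/
noncomputable def dyadicPoint (k j : ℕ) : unitInterval :=
  Set.projIcc (0 : ℝ) 1 zero_le_one ((j : ℝ) / 2 ^ k)

/-- The index of the dyadic interval of level `k` that contains `t`; the last interval
is closed on the right. -/
noncomputable def dyadicIndex (k : ℕ) (t : unitInterval) : ℕ :=
  min ⌊(2 : ℝ) ^ k * t⌋₊ (2 ^ k - 1)

lemma dyadicPoint_mono (k : ℕ) : Monotone (dyadicPoint k) := fun a b h =>
  Set.monotone_projIcc _ (by gcongr)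

lemma coe_dyadicPoint {k j : ℕ} (h : j ≤ 2 ^ k) : (dyadicPoint k j : ℝ) = j / 2 ^ k := by
  have h' : (j : ℝ) ≤ 2 ^ k := by exact_mod_cast h
  rw [dyadicPoint, Set.projIcc_of_mem]
  exact ⟨by positivity, div_le_one_of_le₀ h' (by positivity)⟩

lemma dyadicPoint_succ (k j : ℕ) : dyadicPoint (k + 1) (2 * j) = dyadicPoint k j := by
  unfold dyadicPoint
  congr 1
  push_cast
  rw [pow_succ]
  field_simp

lemma dyadicIndex_lt (k : ℕ) (t : unitInterval) : dyadicIndex k t < 2 ^ k := by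
  have : 0 < 2 ^ k := by positivity
  unfold dyadicIndex
  omega

lemma dyadicIndex_mono (k : ℕ) : Monotone (dyadicIndex k) := fun a b h => by
  unfold dyadicIndex
  have : (a : ℝ) ≤ b := h
  gcongr

/-- This is the nesting of successive grids. It survives the truncation at the right end because
(2^{k+1} - 1) / 2 = 2^k - 1 in ℕ. -/
lemma dyadicIndex_succ_div_two (k : ℕ) (t : unitInterval) :
    dyadicIndex (k + 1) t / 2 = dyadicIndex k t := by
  unfold dyadicIndex
  have h : ⌊(2 : ℝ) ^ k * t⌋₊ = ⌊(2 : ℝ) ^ (k + 1) * t⌋₊ / 2 := by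
    rw [← Nat.floor_div_natCast]
    congr 1
    push_cast
    ring
  have : 0 < 2 ^ k := by positivity
  rw [h, pow_succ]
  omega

lemma dyadicPoint_dyadicIndex_le (k : ℕ) (t : unitInterval) :
    dyadicPoint k (dyadicIndex k t) ≤ t := by
  rw [← Subtype.coe_le_coe, coe_dyadicPoint (dyadicIndex_lt k t).le, div_le_iff₀ (by positivity),
    mul_comm]
  have h : (dyadicIndex k t : ℝ) ≤ ⌊(2 : ℝ) ^ k * t⌋₊ := by
    rw [Nat.cast_le]
    exact min_le_left _ _
  exact h.trans (Nat.floor_le (mul_nonneg (by positivity) t.2.1))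

lemma le_dyadicPoint_dyadicIndex_succ (k : ℕ) (t : unitInterval) :
    t ≤ dyadicPoint k (dyadicIndex k t + 1) := by
  rw [← Subtype.coe_le_coe, coe_dyadicPoint (dyadicIndex_lt k t), le_div_iff₀ (by positivity),
    mul_comm]
  have h2 : (0 : ℕ) < 2 ^ k := by positivity
  rcases le_total ⌊(2 : ℝ) ^ k * t⌋₊ (2 ^ k - 1) with h | h
  · rw [dyadicIndex, min_eq_left h]
    push_cast
    exact (Nat.lt_floor_add_one _).le
  · rw [dyadicIndex, min_eq_right h, Nat.succ_eq_add_one, Nat.sub_add_cancel h2]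
    push_cast
    exact mul_le_of_le_one_right (by positivity) t.2.2

lemma dyadicIndex_eq_of_mem_Ico {k j : ℕ} (hj : j < 2 ^ k) {t : unitInterval}
    (ht : t ∈ Set.Ico (dyadicPoint k j) (dyadicPoint k (j + 1))) : dyadicIndex k t = j := by
  obtain ⟨h1, h2⟩ := ht
  rw [← Subtype.coe_le_coe, coe_dyadicPoint hj.le, div_le_iff₀ (by positivity), mul_comm] at h1
  rw [← Subtype.coe_lt_coe, coe_dyadicPoint hj, lt_div_iff₀ (by positivity), mul_comm] at h2
  have : ⌊(2 : ℝ) ^ k * t⌋₊ = j := by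
    rw [Nat.floor_eq_iff (mul_nonneg (by positivity) t.2.1)]
    exact ⟨h1, by exact_mod_cast h2⟩
  rw [dyadicIndex, this]
  omega

lemma measurable_dyadicIndex (k : ℕ) : Measurable (dyadicIndex k) :=
  (dyadicIndex_mono k).measurable

/-- The multi-index of the dyadic cell of level `k` that contains `x`. -/
noncomputable def cellIndex {d : ℕ} (k : ℕ) (x : UnitCube d) : Fin d → ℕ :=
  fun i => dyadicIndex k (x i)

/-- The multi-indices of the dyadic cells of level `k`. -/
def cells (d k : ℕ) : Finset (Fin d → ℕ) := Fintype.piFinset fun _ => Finset.range (2 ^ k)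

/-- The vertex `(c + e) / 2^k` of the dyadic grid. -/
noncomputable def cellCorner {d : ℕ} (k : ℕ) (c : Fin d → ℕ) (e : Fin d → Fin 2) : UnitCube d :=
  fun i => dyadicPoint k (c i + e i)

/-- The lower corner of a dyadic cell. -/
noncomputable def lowerCorner {d : ℕ} (k : ℕ) (c : Fin d → ℕ) : UnitCube d :=
  fun i => dyadicPoint k (c i)

/-- The index of the child `e` of the cell with index `c`. -/
def childIndex {d : ℕ} (c : Fin d → ℕ) (e : Fin d → Fin 2) : Fin d → ℕ := fun i => 2 * c i + e i

lemma cellCorner_zero {d : ℕ} (k : ℕ) (c : Fin d → ℕ) : cellCorner k c 0 = lowerCorner k c := by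
  ext i; simp [cellCorner, lowerCorner]

lemma mem_cells {d k : ℕ} {c : Fin d → ℕ} : c ∈ cells d k ↔ ∀ i, c i < 2 ^ k := by
  simp [cells]

lemma card_cells (d k : ℕ) : (cells d k).card = (2 ^ k) ^ d := by
  simp [cells]

lemma cellIndex_mem_cells {d : ℕ} (k : ℕ) (x : UnitCube d) : cellIndex k x ∈ cells d k :=
  mem_cells.2 fun i => dyadicIndex_lt k (x i)

lemma measurable_cellIndex {d : ℕ} (k : ℕ) : Measurable (cellIndex k : UnitCube d → Fin d → ℕ) :=
  measurable_pi_lambda _ fun i => (measurable_dyadicIndex k).comp (measurable_pi_apply i)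

lemma exists_cellIndex_succ {d : ℕ} (k : ℕ) (x : UnitCube d) :
    ∃ e, cellIndex (k + 1) x = childIndex (cellIndex k x) e := by
  refine ⟨fun i => ⟨dyadicIndex (k + 1) (x i) % 2, Nat.mod_lt _ two_pos⟩, funext fun i => ?_⟩
  simp only [cellIndex, childIndex, ← dyadicIndex_succ_div_two k (x i)]
  omega

lemma childIndex_mem_cells {d k : ℕ} {c : Fin d → ℕ} (hc : c ∈ cells d k) (e : Fin d → Fin 2) :
    childIndex c e ∈ cells d (k + 1) := by
  rw [mem_cells] at *
  intro i
  have := hc i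
  have := (e i).2
  simp only [childIndex, pow_succ]
  omega

/-- Summing over the cells of level `k + 1` is summing over the children of the cells of
level `k`. -/
lemma sum_cells_succ {d : ℕ} (k : ℕ) (g : (Fin d → ℕ) → ℝ) :
    ∑ c ∈ cells d k, ∑ e, g (childIndex c e) = ∑ c ∈ cells d (k + 1), g c := by
  rw [← Finset.sum_product']
  refine Finset.sum_bij (fun q _ => childIndex q.1 q.2) ?_ ?_ ?_ ?_
  · intro q hq
    exact childIndex_mem_cells (Finset.mem_product.1 hq).1 _
  · rintro ⟨c, e⟩ - ⟨c', e'⟩ - h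
    have h' : ∀ i, c i = c' i ∧ e i = e' i := fun i => by
      have := congrFun h i
      simp only [childIndex] at this
      have := (e i).2
      have := (e' i).2
      exact ⟨by omega, Fin.ext (by omega)⟩
    exact Prod.ext (funext fun i => (h' i).1) (funext fun i => (h' i).2)
  · intro c hc
    rw [mem_cells] at hc
    refine ⟨(fun i => c i / 2, fun i => ⟨c i % 2, Nat.mod_lt _ two_pos⟩), ?_, ?_⟩
    · simp only [Finset.mem_product, Finset.mem_univ, and_true, mem_cells]
      intro i
      have := hc i
      rw [pow_succ] at this
      omega
    · funext i
      simp only [childIndex]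
      omega
  · intros; rfl

lemma lowerCorner_childIndex {d : ℕ} (k : ℕ) (c : Fin d → ℕ) (e : Fin d → Fin 2) (i : Fin d) :
    lowerCorner (k + 1) (childIndex c e) i ∈
      Set.Icc (dyadicPoint k (c i)) (dyadicPoint k (c i + 1)) := by
  have := (e i).2
  rw [← dyadicPoint_succ, ← dyadicPoint_succ k (c i + 1)]
  exact ⟨dyadicPoint_mono _ (by simp only [childIndex]; omega),
    dyadicPoint_mono _ (by simp only [childIndex]; omega)⟩

lemma mem_Icc_cellIndex {d : ℕ} (k : ℕ) (x : UnitCube d) (i : Fin d) :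
    x i ∈ Set.Icc (dyadicPoint k (cellIndex k x i)) (dyadicPoint k (cellIndex k x i + 1)) :=
  ⟨dyadicPoint_dyadicIndex_le k _, le_dyadicPoint_dyadicIndex_succ k _⟩

/-- The closed right end spoils a uniform product formula, so the cell is squeezed between a
half-open and a closed box of equal volume. -/
lemma volume_cell {d k : ℕ} {c : Fin d → ℕ} (hc : c ∈ cells d k) :
    volume {x : UnitCube d | cellIndex k x = c} = ENNReal.ofReal (((2 : ℝ) ^ k)⁻¹ ^ d) := by
  have hw : ∀ i, (dyadicPoint k (c i + 1) : ℝ) - dyadicPoint k (c i) = ((2 : ℝ) ^ k)⁻¹ := fun i => by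
    have := mem_cells.1 hc i
    rw [coe_dyadicPoint this, coe_dyadicPoint this.le]
    push_cast
    field_simp
    ring
  apply le_antisymm
  · calc volume {x : UnitCube d | cellIndex k x = c}
        ≤ volume (Set.univ.pi fun i => Set.Icc (dyadicPoint k (c i)) (dyadicPoint k (c i + 1))) := by
          apply measure_mono
          rintro x rfl i -
          exact mem_Icc_cellIndex k x i
      _ = ENNReal.ofReal (((2 : ℝ) ^ k)⁻¹ ^ d) := by
          rw [volume_pi_pi]
          simp_rw [unitInterval.volume_Icc, hw]
          rw [ENNReal.ofReal_pow (by positivity), Finset.prod_const, Finset.card_univ, Fintype.card_fin]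
  · calc ENNReal.ofReal (((2 : ℝ) ^ k)⁻¹ ^ d)
        = volume (Set.univ.pi fun i => Set.Ico (dyadicPoint k (c i)) (dyadicPoint k (c i + 1))) := by
          rw [volume_pi_pi]
          simp_rw [unitInterval.volume_Ico, hw]
          rw [ENNReal.ofReal_pow (by positivity), Finset.prod_const, Finset.card_univ, Fintype.card_fin]
      _ ≤ _ := by
          apply measure_mono
          intro x hx
          funext i
          exact dyadicIndex_eq_of_mem_Ico (mem_cells.1 hc i) (hx i trivial)

/-- The measure of a union of dyadic cells. -/
lemma volume_cellIndex_preimage {d k : ℕ} {s : Finset (Fin d → ℕ)} (hs : s ⊆ cells d k) :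
    volume {x : UnitCube d | cellIndex k x ∈ s} =
      ENNReal.ofReal (s.card * ((2 : ℝ) ^ k)⁻¹ ^ d) := by
  have : {x : UnitCube d | cellIndex k x ∈ s} = ⋃ c ∈ s, {x | cellIndex k x = c} := by
    ext x; simp
  rw [this, measure_biUnion_finset]
  · rw [Finset.sum_congr rfl fun c hc => volume_cell (hs hc), Finset.sum_const, nsmul_eq_mul,
      ENNReal.ofReal_mul (by positivity), ENNReal.ofReal_natCast]
  · intro a _ b _ hab
    exact Set.disjoint_left.2 fun x hx hx' => hab (hx.symm.trans hx')
  · intro c _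
    exact measurable_cellIndex k (measurableSet_singleton c)

/-- The integral of a function that is constant on dyadic cells. -/
lemma lintegral_cellIndex {d : ℕ} (k : ℕ) (g : (Fin d → ℕ) → ℝ≥0∞) :
    ∫⁻ x : UnitCube d, g (cellIndex k x) =
      (∑ c ∈ cells d k, g c) * ENNReal.ofReal (((2 : ℝ) ^ k)⁻¹ ^ d) := by
  have h : ∀ x : UnitCube d, g (cellIndex k x) =
      ∑ c ∈ cells d k, Set.indicator {x : UnitCube d | cellIndex k x = c} (fun _ => g c) x := by
    intro x
    rw [Finset.sum_eq_single_of_mem (cellIndex k x) (cellIndex_mem_cells k x)]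
    · simp
    · intro c _ hc
      exact Set.indicator_of_notMem (fun h => hc h.symm) _
  have hm : ∀ c, MeasurableSet {x : UnitCube d | cellIndex k x = c} := fun c =>
    measurable_cellIndex k (measurableSet_singleton c)
  simp_rw [h]
  rw [lintegral_finsetSum _ fun c _ => measurable_const.indicator (hm c), Finset.sum_mul]
  refine Finset.sum_congr rfl fun c hc => ?_
  rw [lintegral_indicator (hm c), setLIntegral_const, volume_cell hc]

/-! ### Variation of a coordinatewise monotonic function over a grid -/

/-- The total variation of `f` along the edges in direction `i` of a dyadic cell (each edge is
counted twice). -/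
noncomputable def edgeVariation {d : ℕ} (f : UnitCube d → ℝ) (k : ℕ) (c : Fin d → ℕ) (i : Fin d) :
    ℝ :=
  ∑ e : Fin d → Fin 2, |f (cellCorner k c (Function.update e i 1)) -
    f (cellCorner k c (Function.update e i 0))|

/-- The total variation of `f` along the edges of a dyadic cell. -/
noncomputable def cellVariation {d : ℕ} (f : UnitCube d → ℝ) (k : ℕ) (c : Fin d → ℕ) : ℝ :=
  ∑ i, edgeVariation f k c i

lemma edgeVariation_nonneg {d : ℕ} (f : UnitCube d → ℝ) (k : ℕ) (c : Fin d → ℕ) (i : Fin d) :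
    0 ≤ edgeVariation f k c i :=
  Finset.sum_nonneg fun _ _ => abs_nonneg _

lemma cellVariation_nonneg {d : ℕ} (f : UnitCube d → ℝ) (k : ℕ) (c : Fin d → ℕ) :
    0 ≤ cellVariation f k c :=
  Finset.sum_nonneg fun _ _ => edgeVariation_nonneg _ _ _ _

lemma abs_edge_le_edgeVariation {d : ℕ} (f : UnitCube d → ℝ) (k : ℕ) (c : Fin d → ℕ) (i : Fin d)
    (e : Fin d → Fin 2) :
    |f (cellCorner k c (Function.update e i 1)) - f (cellCorner k c (Function.update e i 0))| ≤
      edgeVariation f k c i :=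
  Finset.single_le_sum (f := fun e : Fin d → Fin 2 =>
    |f (cellCorner k c (Function.update e i 1)) - f (cellCorner k c (Function.update e i 0))|)
    (fun _ _ => abs_nonneg _) (Finset.mem_univ e)

lemma cellCorner_update {d : ℕ} (k : ℕ) (c : Fin d → ℕ) (e : Fin d → Fin 2) (i : Fin d)
    (r : Fin 2) : cellCorner k c (Function.update e i r) =
      Function.update (cellCorner k c e) i (dyadicPoint k (c i + r)) := by
  funext j
  rcases eq_or_ne j i with rfl | h
  · simp [cellCorner]
  · simp [cellCorner, h]

/-- On a face of a dyadic cell a coordinatewise monotonic function deviates from its value at a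
vertex by at most the variation along the edges. -/
lemma abs_sub_cellCorner_le {d : ℕ} {f : UnitCube d → ℝ} (hf : f ∈ monotoneClass d) (k : ℕ)
    (c : Fin d → ℕ) (S : Finset (Fin d)) : ∀ (e : Fin d → Fin 2) (x : UnitCube d),
      (∀ i ∈ S, x i ∈ Set.Icc (dyadicPoint k (c i)) (dyadicPoint k (c i + 1))) →
      (∀ i ∉ S, x i = cellCorner k c e i) →
      |f x - f (cellCorner k c e)| ≤ ∑ i ∈ S, edgeVariation f k c i := by
  induction S using Finset.induction_on with
  | empty =>
    intro e x _ hx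
    have : x = cellCorner k c e := funext fun i => hx i (Finset.notMem_empty i)
    simp [this]
  | insert i S hi ih =>
    intro e x hS hx
    rw [Finset.sum_insert hi]
    -- Both ends of the segment through `x` in direction `i` lie on faces with free coordinates `S`,
    -- so the induction hypothesis applies to each.
    have key : ∀ r : Fin 2,
        |f (Function.update x i (dyadicPoint k (c i + r))) -
          f (cellCorner k c (Function.update e i r))| ≤ ∑ i ∈ S, edgeVariation f k c i := by
      intro r
      apply ih
      · intro j hj
        have hji : j ≠ i := fun h => hi (h ▸ hj)
        rw [Function.update_of_ne hji]
        exact hS j (Finset.mem_insert_of_mem hj)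
      · intro j hj
        rw [cellCorner_update]
        rcases eq_or_ne j i with rfl | hji
        · simp
        · rw [Function.update_of_ne hji, Function.update_of_ne hji]
          exact hx j (by simp [hj, hji])
    have h0 := key 0
    have h1 := key 1
    have hE := abs_edge_le_edgeVariation f k c i e
    have he : f (cellCorner k c e) = f (cellCorner k c (Function.update e i 0)) ∨
        f (cellCorner k c e) = f (cellCorner k c (Function.update e i 1)) := by
      have : e i = 0 ∨ e i = 1 := by omega
      rcases this with h | h
      · left; rw [← h, Function.update_eq_self]
      · right; rw [← h, Function.update_eq_self]
    have hxi := hS i (Finset.mem_insert_self i S)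
    simp only [Fin.val_zero, Fin.val_one, add_zero] at h0 h1
    rw [abs_le] at h0 h1 hE ⊢
    -- `f x` lies between the values at the two ends, and the two vertices nearby differ by at most
    -- the edge variation.
    rcases hf.2 x i with hm | hm
    · have a := hm hxi.1
      have b := hm hxi.2
      simp only [Function.update_eq_self] at a b
      rcases he with he | he <;> rw [he] <;> constructor <;> linarith
    · have a := hm hxi.1
      have b := hm hxi.2
      simp only [Function.update_eq_self] at a b
      rcases he with he | he <;> rw [he] <;> constructor <;> linarith

lemma abs_sub_lowerCorner_le {d : ℕ} {f : UnitCube d → ℝ} (hf : f ∈ monotoneClass d) {k : ℕ}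
    {c : Fin d → ℕ} {x : UnitCube d}
    (hx : ∀ i, x i ∈ Set.Icc (dyadicPoint k (c i)) (dyadicPoint k (c i + 1))) :
    |f x - f (lowerCorner k c)| ≤ cellVariation f k c := by
  rw [← cellCorner_zero]
  exact abs_sub_cellCorner_le hf k c Finset.univ 0 x (fun i _ => hx i)
    (fun i hi => absurd (Finset.mem_univ i) hi)

/-- The variation of a function with values in `[0,1]` along a monotone sequence of points of a
line parallel to an axis. -/
lemma sum_abs_sub_le_one {d : ℕ} {f : UnitCube d → ℝ} (hf : f ∈ monotoneClass d) (x : UnitCube d)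
    (i : Fin d) {y : ℕ → unitInterval} (hy : Monotone y) (N : ℕ) :
    ∑ j ∈ Finset.range N, |f (Function.update x i (y (j + 1))) - f (Function.update x i (y j))|
      ≤ 1 := by
  have hN := hf.1 (Function.update x i (y N))
  have h0 := hf.1 (Function.update x i (y 0))
  rcases hf.2 x i with hm | hm
  · calc _ = ∑ j ∈ Finset.range N,
          (f (Function.update x i (y (j + 1))) - f (Function.update x i (y j))) :=
        Finset.sum_congr rfl fun j _ => abs_of_nonneg (sub_nonneg.2 (hm (hy (Nat.le_succ j))))
      _ ≤ 1 := by
        rw [Finset.sum_range_sub fun j => f (Function.update x i (y j))]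
        linarith
  · calc _ = ∑ j ∈ Finset.range N,
          (f (Function.update x i (y j)) - f (Function.update x i (y (j + 1)))) :=
        Finset.sum_congr rfl fun j _ => by
          rw [abs_sub_comm]
          exact abs_of_nonneg (sub_nonneg.2 (hm (hy (Nat.le_succ j))))
      _ ≤ 1 := by
        rw [Finset.sum_range_sub' fun j => f (Function.update x i (y j))]
        linarith

/-- Averaging over the lines in direction `i`. -/
lemma sum_cells_update {d : ℕ} (k : ℕ) (i : Fin d) (g : (Fin d → ℕ) → ℝ) :
    ∑ c ∈ cells d k, ∑ j ∈ Finset.range (2 ^ k), g (Function.update c i j) =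
      2 ^ k * ∑ c ∈ cells d k, g c := by
  have h : ∑ q ∈ cells d k ×ˢ Finset.range (2 ^ k), g (Function.update q.1 i q.2) =
      ∑ q ∈ cells d k ×ˢ Finset.range (2 ^ k), g q.1 := by
    have hmem : ∀ q ∈ cells d k ×ˢ Finset.range (2 ^ k),
        (Function.update q.1 i q.2, q.1 i) ∈ cells d k ×ˢ Finset.range (2 ^ k) := by
      intro q hq
      simp only [Finset.mem_product, mem_cells, Finset.mem_range] at hq ⊢
      refine ⟨fun j => ?_, hq.1 i⟩
      rcases eq_or_ne j i with rfl | hj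
      · simpa using hq.2
      · simpa [hj] using hq.1 j
    -- Exchanging the `i`-th coordinate of the cell with the running index is an involution of the
    -- product.
    refine Finset.sum_nbij' (fun q => (Function.update q.1 i q.2, q.1 i))
      (fun q => (Function.update q.1 i q.2, q.1 i)) hmem hmem ?_ ?_ ?_ <;> simp
  rw [← Finset.sum_product' (f := fun c j => g (Function.update c i j)), h,
    Finset.sum_product' (f := fun c _ => g c), Finset.mul_sum]
  simp

/-- For each of the 2^d choices of `e`, the edges form 2^{k(d-1)} lines in direction `i`, each of
variation at most 1. -/
lemma sum_edgeVariation_le {d : ℕ} {f : UnitCube d → ℝ} (hf : f ∈ monotoneClass d) (k : ℕ)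
    (i : Fin d) : ∑ c ∈ cells d k, edgeVariation f k c i ≤ 2 ^ d * ((2 : ℝ) ^ k) ^ (d - 1) := by
  unfold edgeVariation
  rw [Finset.sum_comm]
  have hd : 0 < d := i.pos
  have h : ∀ e : Fin d → Fin 2, ∑ c ∈ cells d k,
      |f (cellCorner k c (Function.update e i 1)) - f (cellCorner k c (Function.update e i 0))| ≤
        ((2 : ℝ) ^ k) ^ (d - 1) := by
    intro e
    have hk : (0 : ℝ) < 2 ^ k := by positivity
    rw [← mul_le_mul_iff_right₀ hk, ← sum_cells_update k i, ← pow_succ', Nat.sub_add_cancel hd]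
    calc _ ≤ ∑ c ∈ cells d k, (1 : ℝ) := by
          refine Finset.sum_le_sum fun c _ => ?_
          have key : ∀ (j : ℕ) (r : Fin 2),
              cellCorner k (Function.update c i j) (Function.update e i r) =
                Function.update (cellCorner k c e) i (dyadicPoint k (j + r)) := by
            intro j r
            rw [cellCorner_update]
            funext l
            rcases eq_or_ne l i with rfl | hl
            · simp
            · simp [hl, cellCorner]
          simp only [key, Fin.val_one, Fin.val_zero, add_zero]
          exact sum_abs_sub_le_one hf _ i (dyadicPoint_mono k) _
      _ = _ := by
          rw [Finset.sum_const, card_cells]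
          simp
  calc _ ≤ ∑ e : Fin d → Fin 2, ((2 : ℝ) ^ k) ^ (d - 1) := Finset.sum_le_sum fun e _ => h e
    _ = _ := by simp

/-- The sum of the variations over all cells of a grid of mesh `2⁻ᵏ` is of order
`2^{k(d-1)}`. -/
lemma sum_cellVariation_le {d : ℕ} {f : UnitCube d → ℝ} (hf : f ∈ monotoneClass d) (k : ℕ) :
    ∑ c ∈ cells d k, cellVariation f k c ≤ d * 2 ^ d * ((2 : ℝ) ^ k) ^ (d - 1) := by
  unfold cellVariation
  rw [Finset.sum_comm]
  calc _ ≤ ∑ i : Fin d, 2 ^ d * ((2 : ℝ) ^ k) ^ (d - 1) :=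
        Finset.sum_le_sum fun i _ => sum_edgeVariation_le hf k i
    _ = _ := by simp [mul_assoc]

/-! ### Integer labelled trees -/

/-- Trees of depth at most `h`, with branches indexed by `E` and nodes labelled by integers. -/
def LabelledTree (E : Type) : ℕ → Type
  | 0 => ℤ
  | h + 1 => ℤ × Option (E → LabelledTree E h)

/-- The cost of a labelled tree is the sum of `3 + |a|` over the labels `a` of its nodes. -/
noncomputable def LabelledTree.cost {E : Type} [Fintype E] : (h : ℕ) → LabelledTree E h → ℝ
  | 0, a => 3 + |((show ℤ from a : ℤ) : ℝ)|
  | _ + 1, (a, none) => 3 + |(a : ℝ)|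
  | h + 1, (a, some φ) => 3 + |(a : ℝ)| + ∑ e, LabelledTree.cost h (φ e)

/-- Since e ≥ 2, the offset 3 gives weight at most 2^{-|a|}/8, and the labels of either sign
contribute at most 2/8. The bound 1/2 leaves room for the choice, at each node, between a leaf and a
branching. -/
lemma sum_exp_neg_abs_le (s : Finset ℤ) : ∑ a ∈ s, Real.exp (-(3 + |(a : ℝ)|)) ≤ 1 / 2 := by
  have he : (2 : ℝ) ≤ Real.exp 1 := by
    have := Real.add_one_le_exp (1 : ℝ); linarith
  have hle : ∀ a : ℤ, Real.exp (-(3 + |(a : ℝ)|)) ≤ (1 / 8) * (1 / 2) ^ a.natAbs := by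
    intro a
    have hq : Real.exp (-1) ≤ 1 / 2 := by
      rw [Real.exp_neg, one_div]
      exact inv_anti₀ two_pos he
    have : -(3 + |(a : ℝ)|) = ((3 + a.natAbs : ℕ) : ℝ) * (-1) := by
      push_cast
      rw [← Int.cast_natCast, Int.natCast_natAbs, Int.cast_abs]
      ring
    rw [this, Real.exp_nat_mul]
    calc _ ≤ (1 / 2 : ℝ) ^ (3 + a.natAbs) := by gcongr
      _ = _ := by rw [pow_add]; norm_num
  have hgeom : ∀ u : Finset ℤ, Set.InjOn Int.natAbs (u : Set ℤ) →
      ∑ a ∈ u, (1 / 2 : ℝ) ^ a.natAbs ≤ 2 := by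
    intro u hu
    rw [← Finset.sum_image (f := fun n : ℕ => (1 / 2 : ℝ) ^ n) hu]
    exact (summable_geometric_two.sum_le_tsum _ fun _ _ => by positivity).trans_eq
      tsum_geometric_two
  have h1 := hgeom (s.filter fun a => 0 ≤ a) (by
    intro a ha b hb hab
    simp only [Finset.coe_filter, Set.mem_ofPred_eq] at ha hb
    omega)
  have h2 := hgeom (s.filter fun a => ¬ 0 ≤ a) (by
    intro a ha b hb hab
    simp only [Finset.coe_filter, Set.mem_ofPred_eq] at ha hb
    omega)
  calc _ ≤ ∑ a ∈ s, (1 / 8 : ℝ) * (1 / 2) ^ a.natAbs := Finset.sum_le_sum fun a _ => hle a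
    _ = (1 / 8 : ℝ) * ∑ a ∈ s, (1 / 2 : ℝ) ^ a.natAbs := by rw [Finset.mul_sum]
    _ ≤ 1 / 2 := by
      rw [← Finset.sum_filter_add_sum_filter_not s fun a => 0 ≤ a]
      linarith

/-- A Kraft inequality for labelled trees. -/
lemma LabelledTree.sum_exp_neg_cost_le_one {E : Type} [Fintype E] : ∀ (h : ℕ)
    (s : Finset (LabelledTree E h)), ∑ T ∈ s, Real.exp (-LabelledTree.cost h T) ≤ 1
  | 0, s => (sum_exp_neg_abs_le s).trans (by norm_num)
  | h + 1, s => by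
    classical
    have ih := LabelledTree.sum_exp_neg_cost_le_one (E := E) h
    let w : Option (E → LabelledTree E h) → ℝ
      | none => 1
      | some φ => ∏ e, Real.exp (-LabelledTree.cost h (φ e))
    have hw : ∀ o, 0 ≤ w o := by
      rintro (_ | φ)
      · exact zero_le_one
      · exact Finset.prod_nonneg fun _ _ => (Real.exp_pos _).le
    have hcost : ∀ T : ℤ × Option (E → LabelledTree E h),
        Real.exp (-LabelledTree.cost (h + 1) T) = Real.exp (-(3 + |(T.1 : ℝ)|)) * w T.2 := by
      rintro ⟨a, _ | φ⟩
      · simp [LabelledTree.cost, w]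
      · simp only [LabelledTree.cost, w]
        rw [← Real.exp_sum, ← Real.exp_add, Finset.sum_neg_distrib]
        congr 1
        ring
    let t : Finset (ℤ × Option (E → LabelledTree E h)) := s
    let O : Finset (Option (E → LabelledTree E h)) := t.image Prod.snd
    -- A leaf weighs 1. The branchings weigh at most 1 in total: enlarging the set of `φ` to a
    -- product set turns the sum into a product of sums bounded by induction.
    have hO : ∑ o ∈ O, w o ≤ 2 := by
      have hsub : O ⊆ Finset.insertNone (Finset.eraseNone O) := by
        intro o ho
        rcases o with _ | φ
        · exact Finset.none_mem_insertNone
        · exact Finset.some_mem_insertNone.2 (Finset.mem_eraseNone.2 ho)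
      calc ∑ o ∈ O, w o ≤ ∑ o ∈ Finset.insertNone (Finset.eraseNone O), w o :=
            Finset.sum_le_sum_of_subset_of_nonneg hsub fun _ _ _ => hw _
        _ = 1 + ∑ φ ∈ Finset.eraseNone O, ∏ e, Real.exp (-LabelledTree.cost h (φ e)) := by
            rw [Finset.sum_insertNone]
        _ ≤ 1 + ∑ φ ∈ Fintype.piFinset fun e => (Finset.eraseNone O).image fun φ => φ e,
              ∏ e, Real.exp (-LabelledTree.cost h (φ e)) := by
            gcongr
            intro φ hφ
            exact Fintype.mem_piFinset.2 fun e => Finset.mem_image_of_mem _ hφ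
        _ = 1 + ∏ e, ∑ T ∈ (Finset.eraseNone O).image fun φ => φ e,
              Real.exp (-LabelledTree.cost h T) := by
            rw [Finset.prod_univ_sum]
        _ ≤ 1 + 1 := by
            gcongr
            exact Finset.prod_le_one
              (fun _ _ => Finset.sum_nonneg fun _ _ => (Real.exp_pos _).le) fun e _ => ih _
        _ = 2 := by norm_num
    calc ∑ T ∈ s, Real.exp (-LabelledTree.cost (h + 1) T)
        = ∑ T ∈ t, Real.exp (-(3 + |(T.1 : ℝ)|)) * w T.2 := Finset.sum_congr rfl fun T _ => hcost T
      _ ≤ ∑ T ∈ t.image Prod.fst ×ˢ O, Real.exp (-(3 + |(T.1 : ℝ)|)) * w T.2 := by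
          refine Finset.sum_le_sum_of_subset_of_nonneg ?_
            fun _ _ _ => mul_nonneg (Real.exp_pos _).le (hw _)
          intro T hT
          exact Finset.mem_product.2 ⟨Finset.mem_image_of_mem _ hT, Finset.mem_image_of_mem _ hT⟩
      _ = (∑ a ∈ t.image Prod.fst, Real.exp (-(3 + |(a : ℝ)|))) * ∑ o ∈ O, w o := by
          rw [Finset.sum_mul_sum, Finset.sum_product]
      _ ≤ 1 / 2 * 2 := by
          gcongr
          · exact Finset.sum_nonneg fun o _ => hw o
          · exact sum_exp_neg_abs_le _
      _ = 1 := by norm_num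

/-- There are at most `exp L` labelled trees of cost at most `L`. -/
lemma LabelledTree.card_cost_le {E : Type} [Fintype E] (h : ℕ) {L : ℝ}
    {s : Finset (LabelledTree E h)} (hs : ∀ T ∈ s, LabelledTree.cost h T ≤ L) :
    (s.card : ℝ) ≤ Real.exp L := by
  have h1 : (s.card : ℝ) * Real.exp (-L) ≤ 1 := by
    calc (s.card : ℝ) * Real.exp (-L) = ∑ T ∈ s, Real.exp (-L) := by simp
      _ ≤ ∑ T ∈ s, Real.exp (-LabelledTree.cost h T) :=
          Finset.sum_le_sum fun T hT => Real.exp_le_exp.2 (neg_le_neg (hs T hT))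
      _ ≤ 1 := LabelledTree.sum_exp_neg_cost_le_one h s
  rw [Real.exp_neg, ← div_eq_mul_inv] at h1
  exact (div_le_one (Real.exp_pos L)).1 h1

/-- The bound on cardinalities is uniform over finite subsets, which rules out an infinite set. -/
lemma LabelledTree.finite_cost_le {E : Type} [Fintype E] (h : ℕ) (L : ℝ) :
    {T : LabelledTree E h | LabelledTree.cost h T ≤ L}.Finite := by
  by_contra hinf
  obtain ⟨t, ht, hcard⟩ := Set.Infinite.exists_subset_card_eq hinf (⌊Real.exp L⌋₊ + 1)
  have := LabelledTree.card_cost_le h (L := L) (s := t) fun T hT => ht hT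
  rw [hcard] at this
  push_cast at this
  exact absurd (Nat.lt_floor_add_one (Real.exp L)) (not_lt.2 this)

/-! ### Adaptive dyadic partitions

The cube is partitioned adaptively: a cell of level `k` is subdivided if `k < n` or if the variation
of `f` over it exceeds the threshold `t k`. -/

/-- Whether a dyadic cell has to be subdivided. -/
def NeedsSplit {d : ℕ} (n : ℕ) (t : ℕ → ℝ) (f : UnitCube d → ℝ) (k : ℕ) (c : Fin d → ℕ) : Prop :=
  k < n ∨ t k < cellVariation f k c

/-- The value of `f` at the lower corner of a cell, rounded down to a multiple of `t k`. -/
noncomputable def roundedValue {d : ℕ} (t : ℕ → ℝ) (f : UnitCube d → ℝ) (k : ℕ) (c : Fin d → ℕ) :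
    ℤ :=
  ⌊f (lowerCorner k c) / t k⌋

open Classical in
/-- The tree that encodes the adaptive partition, starting from the cell `c` of level `k`, and the
rounded values of `f`, each one relative to a prediction computed from its parent. -/
noncomputable def encode {d : ℕ} (n : ℕ) (t : ℕ → ℝ) (f : UnitCube d → ℝ) :
    (h k : ℕ) → (Fin d → ℕ) → ℤ → LabelledTree (Fin d → Fin 2) h
  | 0, k, c, b => (roundedValue t f k c - b : ℤ)
  | h + 1, k, c, b => (roundedValue t f k c - b,
      if NeedsSplit n t f k c then
        some fun e => encode n t f h (k + 1) (childIndex c e)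
          -- The prediction is the parent's rounded value converted to units of `t (k + 1)`; it can
          -- be recovered from the code alone.
          ⌊(roundedValue t f k c : ℝ) * (t k / t (k + 1))⌋
      else none)

open Classical in
/-- The level of the cell of the adaptive partition that contains `x`, where the partition starts
from level `k` and makes at most `h` subdivisions. -/
noncomputable def leafLevel {d : ℕ} (n : ℕ) (t : ℕ → ℝ) (f : UnitCube d → ℝ) (x : UnitCube d) :
    (h k : ℕ) → ℕ
  | 0, k => k
  | h + 1, k => if NeedsSplit n t f k (cellIndex k x) then leafLevel n t f x h (k + 1) else k

section Leaf

variable {d : ℕ} {n : ℕ} {t : ℕ → ℝ} {f g : UnitCube d → ℝ}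

lemma le_leafLevel (x : UnitCube d) : ∀ h k, k ≤ leafLevel n t f x h k
  | 0, _ => le_rfl
  | h + 1, k => by
    unfold leafLevel
    split_ifs
    · exact (Nat.le_succ k).trans (le_leafLevel x h (k + 1))
    · exact le_rfl

lemma leafLevel_le (x : UnitCube d) : ∀ h k, leafLevel n t f x h k ≤ k + h
  | 0, _ => le_rfl
  | h + 1, k => by
    unfold leafLevel
    split_ifs
    · exact (leafLevel_le x h (k + 1)).trans (by omega)
    · omega

lemma leafLevel_eq_or_not_needsSplit (x : UnitCube d) : ∀ h k, leafLevel n t f x h k = k + h ∨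
    ¬ NeedsSplit n t f (leafLevel n t f x h k) (cellIndex (leafLevel n t f x h k) x)
  | 0, _ => Or.inl rfl
  | h + 1, k => by
    by_cases hk : NeedsSplit n t f k (cellIndex k x)
    · simp only [leafLevel, if_pos hk]
      rcases leafLevel_eq_or_not_needsSplit x h (k + 1) with h' | h'
      · left; omega
      · exact Or.inr h'
    · simp only [leafLevel, if_neg hk]
      exact Or.inr hk

/-- All proper ancestors of a leaf were subdivided. For the parent of a leaf beyond level `n` this
yields a lower bound on the variation, the input to Markov's inequality. -/
lemma needsSplit_of_lt_leafLevel (x : UnitCube d) : ∀ h k j, k ≤ j → j < leafLevel n t f x h k →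
    NeedsSplit n t f j (cellIndex j x)
  | 0, k, j, hkj, hj => absurd hj (not_lt.2 hkj)
  | h + 1, k, j, hkj, hj => by
    by_cases hk : NeedsSplit n t f k (cellIndex k x)
    · simp only [leafLevel, if_pos hk] at hj
      rcases hkj.eq_or_lt with rfl | hlt
      · exact hk
      · exact needsSplit_of_lt_leafLevel x h (k + 1) j hlt hj
    · simp only [leafLevel, if_neg hk] at hj
      exact absurd hj (not_lt.2 hkj)

/-- The tests see `x` only through discrete cell indices, so `f` itself need not be measurable. -/
lemma measurable_leafLevel : ∀ h k, Measurable fun x : UnitCube d => leafLevel n t f x h k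
  | 0, _ => measurable_const
  | h + 1, k => by
    unfold leafLevel
    refine Measurable.ite ?_ (measurable_leafLevel h (k + 1)) measurable_const
    exact measurable_cellIndex k
      (MeasurableSet.of_discrete (s := {c : Fin d → ℕ | NeedsSplit n t f k c}))

/-- Functions with the same code have the same adaptive partition and the same rounded values. -/
lemma leafLevel_eq_of_encode_eq (x : UnitCube d) : ∀ (h k : ℕ) (b : ℤ),
    encode n t f h k (cellIndex k x) b = encode n t g h k (cellIndex k x) b →
    leafLevel n t f x h k = leafLevel n t g x h k ∧
      roundedValue t f (leafLevel n t g x h k) (cellIndex (leafLevel n t g x h k) x) =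
        roundedValue t g (leafLevel n t g x h k) (cellIndex (leafLevel n t g x h k) x)
  | 0, k, b, hfg => ⟨rfl, sub_left_injective (b := b) hfg⟩
  | h + 1, k, b, hfg => by
    unfold encode at hfg
    have h1 := sub_left_injective (congrArg Prod.fst hfg)
    have h2 := congrArg Prod.snd hfg
    simp only at h1 h2
    by_cases hf : NeedsSplit n t f k (cellIndex k x) <;>
      by_cases hg : NeedsSplit n t g k (cellIndex k x)
    · rw [if_pos hf, if_pos hg, Option.some.injEq] at h2
      obtain ⟨e, he⟩ := exists_cellIndex_succ k x
      have h3 := congrFun h2 e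
      -- Equal rounded values give equal predictions, so the recursion continues with a common `b`.
      rw [← he, h1] at h3
      simp only [leafLevel, if_pos hf, if_pos hg]
      exact leafLevel_eq_of_encode_eq x h (k + 1) _ h3
    · simp [hf, hg] at h2
    · simp [hf, hg] at h2
    · simp only [leafLevel, if_neg hf, if_neg hg]
      exact ⟨trivial, h1⟩

/-- On a cell of the adaptive partition, `f` is close to its value at the lower corner. -/
lemma abs_sub_leaf_le (hf : f ∈ monotoneClass d) {K : ℕ} (htK : 1 ≤ t K) (x : UnitCube d) :
    |f x - f (lowerCorner (leafLevel n t f x K 0) (cellIndex (leafLevel n t f x K 0) x))| ≤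
      t (leafLevel n t f x K 0) := by
  rcases leafLevel_eq_or_not_needsSplit (n := n) (t := t) (f := f) x K 0 with h | h
  · rw [zero_add] at h
    rw [h]
    -- At the maximal depth no test was made, but values in [0,1] oscillate by at most 1 ≤ `t K`.
    refine le_trans ?_ htK
    have h1 := hf.1 x
    have h2 := hf.1 (lowerCorner K (cellIndex K x))
    rw [abs_le]
    constructor <;> linarith
  · simp only [NeedsSplit, not_or, not_lt] at h
    exact (abs_sub_lowerCorner_le hf fun i => mem_Icc_cellIndex _ x i).trans h.2

lemma abs_sub_le_of_floor_eq {a b s : ℝ} (hs : 0 < s) (h : ⌊a / s⌋ = ⌊b / s⌋) : |a - b| ≤ s := by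
  have := (Int.abs_sub_lt_one_of_floor_eq_floor h).le
  rwa [← sub_div, abs_div, abs_of_pos hs, div_le_one hs] at this

end Leaf

/-! ### The cost of the code -/

section Cost

variable {d : ℕ} {n : ℕ} {t : ℕ → ℝ} {f : UnitCube d → ℝ}

/-- The prediction error for the rounded value in a child. -/
lemma abs_roundedValue_child_le (hf : f ∈ monotoneClass d) {k : ℕ} (ht : 0 < t k)
    (ht' : t k ≤ 2 * t (k + 1)) (c : Fin d → ℕ) (e : Fin d → Fin 2) :
    |((roundedValue t f (k + 1) (childIndex c e) -
      ⌊(roundedValue t f k c : ℝ) * (t k / t (k + 1))⌋ : ℤ) : ℝ)| ≤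
        4 + 2 * (cellVariation f k c / t k) := by
  have ht1 : 0 < t (k + 1) := by linarith
  have hV := abs_sub_lowerCorner_le hf (x := lowerCorner (k + 1) (childIndex c e))
    (lowerCorner_childIndex k c e)
  set V := cellVariation f k c
  set a := f (lowerCorner k c)
  set b := f (lowerCorner (k + 1) (childIndex c e))
  have hV0 : 0 ≤ V := cellVariation_nonneg f k c
  set r := t k / t (k + 1) with hr
  have hr0 : 0 < r := div_pos ht ht1
  have hr2 : r ≤ 2 := by rw [hr, div_le_iff₀ ht1]; exact ht'
  have hVt : V / t (k + 1) ≤ 2 * (V / t k) := by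
    have : V / t (k + 1) = r * (V / t k) := by rw [hr]; field_simp
    rw [this]
    gcongr
  have hba : |b / t (k + 1) - a / t (k + 1)| ≤ V / t (k + 1) := by
    rw [← sub_div, abs_div, abs_of_pos ht1]
    gcongr
  have har : a / t (k + 1) = a / t k * r := by rw [hr]; field_simp
  have f1 := Int.floor_le (a / t k)
  have f2 := Int.lt_floor_add_one (a / t k)
  have g1 := Int.floor_le (b / t (k + 1))
  have g2 := Int.lt_floor_add_one (b / t (k + 1))
  have k1 := Int.floor_le ((⌊a / t k⌋ : ℝ) * r)
  have k2 := Int.lt_floor_add_one ((⌊a / t k⌋ : ℝ) * r)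
  have m1 : (⌊a / t k⌋ : ℝ) * r ≤ a / t k * r := by gcongr
  -- Rescaling the parent's floor costs at most r ≤ 2. With one unit for each of the other two
  -- floors this explains the constant 4.
  have m2 : a / t k * r ≤ (⌊a / t k⌋ : ℝ) * r + 2 := by nlinarith
  rw [har] at hba
  rw [abs_le] at hba ⊢
  unfold roundedValue
  push_cast
  change -(4 + 2 * (V / t k)) ≤ (⌊b / t (k + 1)⌋ : ℝ) - ⌊(⌊a / t k⌋ : ℝ) * r⌋ ∧
    (⌊b / t (k + 1)⌋ : ℝ) - ⌊(⌊a / t k⌋ : ℝ) * r⌋ ≤ 4 + 2 * (V / t k)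
  constructor <;> linarith [hba.1, hba.2]

/-- A bound for the cost of the children of a cell that is subdivided. -/
noncomputable def splitCost {d : ℕ} (n : ℕ) (t : ℕ → ℝ) (f : UnitCube d → ℝ) (k : ℕ)
    (c : Fin d → ℕ) : ℝ :=
  2 ^ d * ((if k < n then 7 else 0) + 9 * (cellVariation f k c / t k))

/-- The sum of the split costs over all descendants of a cell. -/
noncomputable def totalSplitCost {d : ℕ} (n : ℕ) (t : ℕ → ℝ) (f : UnitCube d → ℝ) :
    (h k : ℕ) → (Fin d → ℕ) → ℝ
  | 0, _, _ => 0
  | h + 1, k, c => splitCost n t f k c + ∑ e, totalSplitCost n t f h (k + 1) (childIndex c e)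

lemma splitCost_nonneg (ht : ∀ k, 0 < t k) (k : ℕ) (c : Fin d → ℕ) : 0 ≤ splitCost n t f k c := by
  have := cellVariation_nonneg f k c
  have := ht k
  unfold splitCost
  positivity

lemma totalSplitCost_nonneg (ht : ∀ k, 0 < t k) : ∀ (h k : ℕ) (c : Fin d → ℕ),
    0 ≤ totalSplitCost n t f h k c
  | 0, _, _ => le_rfl
  | h + 1, k, c => add_nonneg (splitCost_nonneg ht k c)
      (Finset.sum_nonneg fun _ _ => totalSplitCost_nonneg ht h _ _)

/-- All descendants are charged, whether or not the partition reaches them. The total is thus a sum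
over full grids, where the bound on the variation applies. -/
lemma sum_totalSplitCost : ∀ h k : ℕ, ∑ c ∈ cells d k, totalSplitCost n t f h k c =
    ∑ j ∈ Finset.range h, ∑ c ∈ cells d (k + j), splitCost n t f (k + j) c
  | 0, k => by simp [totalSplitCost]
  | h + 1, k => by
    simp only [totalSplitCost]
    rw [Finset.sum_add_distrib, sum_cells_succ, sum_totalSplitCost h (k + 1),
      Finset.sum_range_succ', add_comm]
    simp only [add_zero]
    congr 1
    refine Finset.sum_congr rfl fun j _ => ?_
    rw [show k + 1 + j = k + (j + 1) by ring]

/-- A child costs 3 plus a label of size at most 4 + 2V/t, where V is the variation of its parent.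
From level `n` on, a subdivision means V/t > 1, so the 7 is absorbed into 7V/t; hence the factor 9
in `splitCost`. -/
lemma children_cost_le (ht : ∀ k, 0 < t k) {k : ℕ} {c : Fin d → ℕ}
    (hc : NeedsSplit n t f k c) :
    2 ^ d * (7 + 2 * (cellVariation f k c / t k)) ≤ splitCost n t f k c := by
  have h0 : 0 ≤ cellVariation f k c / t k := div_nonneg (cellVariation_nonneg f k c) (ht k).le
  unfold splitCost
  refine mul_le_mul_of_nonneg_left ?_ (by positivity)
  by_cases hk : k < n
  · rw [if_pos hk]; linarith
  · have hc' : t k < cellVariation f k c := hc.resolve_left hk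
    have : 1 < cellVariation f k c / t k := (one_lt_div (ht k)).2 hc'
    rw [if_neg hk]; linarith

/-- Each subdivided node pays for the labels of its children. Its own label is paid for by its
parent, and therefore appears as a separate term in the induction. -/
lemma cost_encode_le (hf : f ∈ monotoneClass d) (ht : ∀ k, 0 < t k)
    (ht' : ∀ k, t k ≤ 2 * t (k + 1)) : ∀ (h k : ℕ) (c : Fin d → ℕ) (b : ℤ),
    LabelledTree.cost h (encode n t f h k c b) ≤
      3 + |((roundedValue t f k c - b : ℤ) : ℝ)| + totalSplitCost n t f h k c
  | 0, k, c, b => by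
    simp only [encode, LabelledTree.cost, totalSplitCost, add_zero]
    exact le_rfl
  | h + 1, k, c, b => by
    by_cases hc : NeedsSplit n t f k c
    · simp only [encode, if_pos hc, LabelledTree.cost, totalSplitCost]
      gcongr 3 + _ + ?_
      calc _ ≤ ∑ e : Fin d → Fin 2, (7 + 2 * (cellVariation f k c / t k) +
            totalSplitCost n t f h (k + 1) (childIndex c e)) := by
            refine Finset.sum_le_sum fun e _ => ?_
            refine (cost_encode_le hf ht ht' h (k + 1) (childIndex c e) _).trans ?_
            have := abs_roundedValue_child_le hf (ht k) (ht' k) c e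
            linarith
        _ = 2 ^ d * (7 + 2 * (cellVariation f k c / t k)) +
            ∑ e, totalSplitCost n t f h (k + 1) (childIndex c e) := by
            rw [Finset.sum_add_distrib, Finset.sum_const, Finset.card_univ, nsmul_eq_mul]
            congr 2
            simp
        _ ≤ _ := by
            gcongr
            exact children_cost_le ht hc
    · simp only [encode, if_neg hc, LabelledTree.cost]
      exact le_add_of_nonneg_right (totalSplitCost_nonneg ht (h + 1) k c)

/-- The cost of the code of a coordinatewise monotonic function. -/
lemma cost_encode_root_le (hf : f ∈ monotoneClass d) (ht : ∀ k, 0 < t k)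
    (ht' : ∀ k, t k ≤ 2 * t (k + 1)) (ht0 : t 0 = 1) (h : ℕ) :
    LabelledTree.cost h (encode n t f h 0 0 0) ≤ 4 + ∑ k ∈ Finset.range h,
      2 ^ d * ((if k < n then 7 * ((2 : ℝ) ^ k) ^ d else 0) +
        9 * (d * 2 ^ d * ((2 : ℝ) ^ k) ^ (d - 1) / t k)) := by
  have hcells : cells d 0 = {0} := by
    ext c
    rw [mem_cells, Finset.mem_singleton]
    constructor
    · intro hc
      funext i
      have := hc i
      simp only [pow_zero] at this
      simp only [Pi.zero_apply]
      omega
    · rintro rfl i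
      simp
  have h1 := cost_encode_le (n := n) hf ht ht' h 0 0 0
  have h2 := sum_totalSplitCost (n := n) (t := t) (f := f) h 0
  rw [hcells, Finset.sum_singleton] at h2
  -- The root has unit 1 and prediction 0, so its label is at most 1 and it costs at most 3 + 1 = 4.
  have h3 : |((roundedValue t f 0 0 - 0 : ℤ) : ℝ)| ≤ 1 := by
    have hfx := hf.1 (lowerCorner 0 0)
    rw [sub_zero, roundedValue, ht0, div_one, abs_of_nonneg]
    · exact (Int.floor_le _).trans hfx.2
    · exact_mod_cast Int.floor_nonneg.2 hfx.1
  rw [h2] at h1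
  refine h1.trans ?_
  have h4 : ∀ k, ∑ c ∈ cells d k, splitCost n t f k c ≤
      2 ^ d * ((if k < n then 7 * ((2 : ℝ) ^ k) ^ d else 0) +
        9 * (d * 2 ^ d * ((2 : ℝ) ^ k) ^ (d - 1) / t k)) := by
    intro k
    unfold splitCost
    rw [← Finset.mul_sum, Finset.sum_add_distrib, ← Finset.mul_sum, ← Finset.sum_div]
    have := ht k
    gcongr
    · rw [Finset.sum_const, card_cells]
      split_ifs
      · simp [mul_comm]
      · simp
    · exact sum_cellVariation_le hf k
  have h5 := Finset.sum_le_sum fun k (_ : k ∈ Finset.range h) => h4 k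
  simp only [zero_add] at h5 ⊢
  linarith

end Cost

/-! ### Brackets from the adaptive partition -/

section Bracket

variable {d : ℕ} {n : ℕ} {t : ℕ → ℝ} {f g : UnitCube d → ℝ} {K : ℕ}

/-- The value of `g` at the lower corner of the cell of the adaptive partition. -/
noncomputable def leafValue {d : ℕ} (n : ℕ) (t : ℕ → ℝ) (K : ℕ) (g : UnitCube d → ℝ)
    (x : UnitCube d) : ℝ :=
  g (lowerCorner (leafLevel n t g x K 0) (cellIndex (leafLevel n t g x K 0) x))

/-- The threshold on the cell of the adaptive partition. -/
noncomputable def leafWidth {d : ℕ} (n : ℕ) (t : ℕ → ℝ) (K : ℕ) (g : UnitCube d → ℝ)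
    (x : UnitCube d) : ℝ :=
  t (leafLevel n t g x K 0)

lemma measurable_apply_nat {α : Type*} [MeasurableSpace α] {F : ℕ → α → ℝ}
    (hF : ∀ k, Measurable (F k)) {l : α → ℕ} (hl : Measurable l) :
    Measurable fun x => F (l x) x := by
  have h : Measurable fun q : α × ℕ => F q.2 q.1 := measurable_from_prod_countable_left hF
  exact h.comp (measurable_id.prodMk hl)

lemma measurable_leafValue : Measurable (leafValue n t K g) :=
  measurable_apply_nat (F := fun k x => g (lowerCorner k (cellIndex k x)))
    (fun k => (Measurable.of_discrete (f := fun c => g (lowerCorner k c))).comp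
      (measurable_cellIndex k)) (measurable_leafLevel K 0)

lemma measurable_leafWidth : Measurable (leafWidth n t K g) :=
  (measurable_from_top (f := t)).comp (measurable_leafLevel K 0)

/-- Equal codes give the same leaf and the same rounded value at its corner. One width bounds the
oscillation of `f` on the leaf, a second the difference of `f` and `g` at the corner. -/
lemma abs_sub_leafValue_le (hf : f ∈ monotoneClass d) (ht : ∀ k, 0 < t k) (htK : 1 ≤ t K)
    (hfg : encode n t f K 0 0 0 = encode n t g K 0 0 0) (x : UnitCube d) :
    |f x - leafValue n t K g x| ≤ 2 * leafWidth n t K g x := by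
  have h0 : cellIndex 0 x = 0 := by
    funext i
    have := mem_cells.1 (cellIndex_mem_cells 0 x) i
    simp only [pow_zero] at this
    simp only [Pi.zero_apply]
    omega
  rw [← h0] at hfg
  obtain ⟨h1, h2⟩ := leafLevel_eq_of_encode_eq x K 0 0 hfg
  have h3 := abs_sub_leaf_le (n := n) hf htK x
  rw [h1] at h3
  have h4 := abs_sub_le_of_floor_eq (ht _) h2
  rw [abs_le] at h3 h4 ⊢
  unfold leafValue leafWidth
  constructor <;> linarith [h3.1, h3.2, h4.1, h4.2]

lemma memLp_leaf (hg : g ∈ monotoneClass d) (r : ℝ) (p : ℝ≥0∞) :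
    MemLp (fun x => leafValue n t K g x + r * leafWidth n t K g x) p volume := by
  obtain ⟨B, hB⟩ : ∃ B, ∀ k ≤ K, |t k| ≤ B := by
    refine ⟨∑ k ∈ Finset.range (K + 1), |t k|, fun k hk => ?_⟩
    exact Finset.single_le_sum (f := fun k => |t k|) (fun _ _ => abs_nonneg _)
      (Finset.mem_range.2 (Nat.lt_succ_of_le hk))
  refine MemLp.of_bound
    (measurable_leafValue.add (measurable_leafWidth.const_mul r)).aestronglyMeasurable
    (1 + |r| * B) (Filter.Eventually.of_forall fun x => ?_)
  have h1 := hg.1 (lowerCorner (leafLevel n t g x K 0) (cellIndex (leafLevel n t g x K 0) x))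
  have h2 := leafLevel_le (n := n) (t := t) (f := g) x K 0
  rw [zero_add] at h2
  refine (norm_add_le _ _).trans (add_le_add ?_ ?_)
  · rw [Real.norm_eq_abs, leafValue, abs_of_nonneg h1.1]
    exact h1.2
  · rw [Real.norm_eq_abs, abs_mul]
    exact mul_le_mul_of_nonneg_left (hB _ h2) (abs_nonneg r)

/-- Pointwise form of Markov's inequality: a leaf of level k + 1 > `n` has a parent with V > `t k`,
so the factor V / `t k` may be inserted. Adding the terms of all other levels removes the dependence
on the leaf. -/
lemma rpow_leafWidth_le (ht : ∀ k, 0 < t k) (hn : n ≤ K) {p : ℝ} (x : UnitCube d) :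
    (4 * leafWidth n t K g x) ^ p ≤ (4 * t n) ^ p + ∑ k ∈ Finset.Ico n K,
      (4 * t (k + 1)) ^ p / t k * cellVariation g k (cellIndex k x) := by
  have hterm : ∀ k, 0 ≤ (4 * t (k + 1)) ^ p / t k * cellVariation g k (cellIndex k x) := fun k => by
    have := ht k
    have := ht (k + 1)
    have := cellVariation_nonneg g k (cellIndex k x)
    positivity
  have hle := leafLevel_le (n := n) (t := t) (f := g) x K 0
  have hge : n ≤ leafLevel n t g x K 0 := by
    by_contra hlt
    push Not at hlt
    rcases leafLevel_eq_or_not_needsSplit (n := n) (t := t) (f := g) x K 0 with h | h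
    · omega
    · exact h (Or.inl hlt)
  unfold leafWidth
  rcases hge.eq_or_lt with h | h
  · rw [← h]
    exact le_add_of_nonneg_right (Finset.sum_nonneg fun k _ => hterm k)
  · obtain ⟨k, hk⟩ : ∃ k, leafLevel n t g x K 0 = k + 1 := ⟨leafLevel n t g x K 0 - 1, by omega⟩
    have hs := needsSplit_of_lt_leafLevel (n := n) (t := t) (f := g) x K 0 k (Nat.zero_le k)
      (by omega)
    have hV : t k < cellVariation g k (cellIndex k x) := hs.resolve_left (by omega)
    have h4 : 0 ≤ (4 * t n) ^ p := by have := ht n; positivity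
    have h5 : 0 ≤ (4 * t (k + 1)) ^ p := by have := ht (k + 1); positivity
    rw [hk]
    calc (4 * t (k + 1)) ^ p ≤ (4 * t (k + 1)) ^ p / t k * cellVariation g k (cellIndex k x) := by
          rw [div_mul_eq_mul_div, le_div_iff₀ (ht k)]
          gcongr
      _ ≤ ∑ k ∈ Finset.Ico n K, (4 * t (k + 1)) ^ p / t k * cellVariation g k (cellIndex k x) :=
          Finset.single_le_sum
            (f := fun k => (4 * t (k + 1)) ^ p / t k * cellVariation g k (cellIndex k x))
            (fun k _ => hterm k) (Finset.mem_Ico.2 ⟨by omega, by omega⟩)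
      _ ≤ _ := le_add_of_nonneg_left h4

lemma lintegral_cellVariation_le (hg : g ∈ monotoneClass d) (hd : 1 ≤ d) (k : ℕ) :
    ∫⁻ x : UnitCube d, ENNReal.ofReal (cellVariation g k (cellIndex k x)) ≤
      ENNReal.ofReal (d * 2 ^ d * ((2 : ℝ) ^ k)⁻¹) := by
  rw [lintegral_cellIndex k fun c => ENNReal.ofReal (cellVariation g k c),
    ← ENNReal.ofReal_sum_of_nonneg fun c _ => cellVariation_nonneg g k c,
    ← ENNReal.ofReal_mul (Finset.sum_nonneg fun c _ => cellVariation_nonneg g k c)]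
  apply ENNReal.ofReal_le_ofReal
  calc _ ≤ d * 2 ^ d * ((2 : ℝ) ^ k) ^ (d - 1) * ((2 : ℝ) ^ k)⁻¹ ^ d := by
        gcongr
        exact sum_cellVariation_le hg k
    _ = _ := by
        obtain ⟨m, rfl⟩ : ∃ m, d = m + 1 := ⟨d - 1, by omega⟩
        have h2 : (2 : ℝ) ^ k ≠ 0 := by positivity
        rw [Nat.add_sub_cancel, inv_pow, mul_assoc]
        congr 1
        rw [pow_succ ((2 : ℝ) ^ k), mul_inv, ← mul_assoc, mul_inv_cancel₀ (pow_ne_zero _ h2), one_mul]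

lemma eLpNorm_leafWidth_le (hg : g ∈ monotoneClass d) (hd : 1 ≤ d) (ht : ∀ k, 0 < t k)
    (hn : n ≤ K) {p ε : ℝ} (hp : 1 ≤ p) (hε : 0 ≤ ε)
    (hsum : (4 * t n) ^ p + ∑ k ∈ Finset.Ico n K,
      (4 * t (k + 1)) ^ p / t k * (d * 2 ^ d * ((2 : ℝ) ^ k)⁻¹) ≤ ε ^ p) :
    eLpNorm (fun x => 4 * leafWidth n t K g x) (ENNReal.ofReal p) volume ≤ ENNReal.ofReal ε := by
  have hp0 : 0 < p := by linarith
  have hC : ∀ k, 0 ≤ (4 * t (k + 1)) ^ p / t k := fun k => by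
    have := ht k
    have := ht (k + 1)
    positivity
  have hn0 : 0 ≤ (4 * t n) ^ p := by have := ht n; positivity
  rw [eLpNorm_eq_lintegral_rpow_enorm_toReal (by simpa using hp0) ENNReal.ofReal_ne_top,
    ENNReal.toReal_ofReal hp0.le, one_div, ENNReal.rpow_inv_le_iff hp0,
    ENNReal.ofReal_rpow_of_nonneg hε hp0.le]
  refine le_trans ?_ (ENNReal.ofReal_le_ofReal hsum)
  calc ∫⁻ x, ‖4 * leafWidth n t K g x‖ₑ ^ p
      ≤ ∫⁻ x : UnitCube d, (ENNReal.ofReal ((4 * t n) ^ p) + ∑ k ∈ Finset.Ico n K,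
          ENNReal.ofReal ((4 * t (k + 1)) ^ p / t k) *
            ENNReal.ofReal (cellVariation g k (cellIndex k x))) := by
        refine lintegral_mono fun x => ?_
        have hw : 0 ≤ 4 * leafWidth n t K g x := mul_nonneg (by norm_num) (ht _).le
        rw [Real.enorm_eq_ofReal hw, ENNReal.ofReal_rpow_of_nonneg hw hp0.le]
        refine (ENNReal.ofReal_le_ofReal (rpow_leafWidth_le ht hn x)).trans ?_
        refine ENNReal.ofReal_add_le.trans (add_le_add le_rfl ?_)
        rw [ENNReal.ofReal_sum_of_nonneg
          fun k _ => mul_nonneg (hC k) (cellVariation_nonneg g k _)]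
        exact Finset.sum_le_sum fun k _ => (ENNReal.ofReal_mul (hC k)).le
    _ = ENNReal.ofReal ((4 * t n) ^ p) + ∑ k ∈ Finset.Ico n K,
          ENNReal.ofReal ((4 * t (k + 1)) ^ p / t k) *
            ∫⁻ x : UnitCube d, ENNReal.ofReal (cellVariation g k (cellIndex k x)) := by
        have hm : ∀ k, Measurable fun x : UnitCube d =>
            ENNReal.ofReal (cellVariation g k (cellIndex k x)) := fun k =>
          (Measurable.of_discrete (f := fun c => ENNReal.ofReal (cellVariation g k c))).comp
            (measurable_cellIndex k)
        rw [lintegral_add_left measurable_const, lintegral_const, measure_univ, mul_one,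
          lintegral_finsetSum _ fun k _ => (hm k).const_mul _]
        congr 1
        exact Finset.sum_congr rfl fun k _ => lintegral_const_mul _ (hm k)
    _ ≤ ENNReal.ofReal ((4 * t n) ^ p) + ∑ k ∈ Finset.Ico n K,
          ENNReal.ofReal ((4 * t (k + 1)) ^ p / t k * (d * 2 ^ d * ((2 : ℝ) ^ k)⁻¹)) := by
        gcongr with k hk
        rw [ENNReal.ofReal_mul (hC k)]
        gcongr
        exact lintegral_cellVariation_le hg hd k
    _ = _ := by
        rw [ENNReal.ofReal_add hn0 (Finset.sum_nonneg fun k _ => mul_nonneg (hC k) (by positivity)),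
          ENNReal.ofReal_sum_of_nonneg fun k _ => mul_nonneg (hC k) (by positivity)]

/-- The bracketing produced by adaptive partitions with thresholds `t`. -/
lemma exists_hasLpBracketing (hd : 1 ≤ d) (ht : ∀ k, 0 < t k) (ht' : ∀ k, t k ≤ 2 * t (k + 1))
    (ht0 : t 0 = 1) (hn : n ≤ K) (htK : 1 ≤ t K) {p ε L : ℝ} (hp : 1 ≤ p) (hε : 0 ≤ ε)
    (hsum : (4 * t n) ^ p + ∑ k ∈ Finset.Ico n K,
      (4 * t (k + 1)) ^ p / t k * (d * 2 ^ d * ((2 : ℝ) ^ k)⁻¹) ≤ ε ^ p)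
    (hL : 4 + ∑ k ∈ Finset.range K, 2 ^ d * ((if k < n then 7 * ((2 : ℝ) ^ k) ^ d else 0) +
        9 * (d * 2 ^ d * ((2 : ℝ) ^ k) ^ (d - 1) / t k)) ≤ L) :
    ∃ m : ℕ, HasLpBracketing (monotoneClass d) p ε m ∧ (m : ℝ) ≤ Real.exp L := by
  set A : Set (LabelledTree (Fin d → Fin 2) K) :=
    (fun f => encode n t f K 0 0 0) '' monotoneClass d with hA
  have hcost : ∀ T ∈ A, LabelledTree.cost K T ≤ L := by
    rintro _ ⟨f, hf, rfl⟩
    exact (cost_encode_root_le hf ht ht' ht0 K).trans hL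
  have hfin : A.Finite := (LabelledTree.finite_cost_le K L).subset hcost
  refine ⟨hfin.toFinset.card, ?_,
    LabelledTree.card_cost_le K fun T hT => hcost T (hfin.mem_toFinset.1 hT)⟩
  let eq := hfin.toFinset.equivFin
  -- One representative per code; its leaf values plus and minus twice the leaf width bracket every
  -- function with that code.
  have hrep : ∀ k, ∃ g ∈ monotoneClass d, encode n t g K 0 0 0 = (eq.symm k).1 := fun k =>
    hfin.mem_toFinset.1 (eq.symm k).2
  choose g hg hgk using hrep
  refine ⟨fun k x => leafValue n t K (g k) x + (-2) * leafWidth n t K (g k) x,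
    fun k x => leafValue n t K (g k) x + 2 * leafWidth n t K (g k) x,
    fun k => ⟨memLp_leaf (hg k) _ _, memLp_leaf (hg k) _ _, ?_⟩, ?_⟩
  · have : (fun x => leafValue n t K (g k) x + 2 * leafWidth n t K (g k) x) -
        (fun x => leafValue n t K (g k) x + (-2) * leafWidth n t K (g k) x) =
          fun x => 4 * leafWidth n t K (g k) x := by
      funext x
      simp only [Pi.sub_apply]
      ring
    rw [this]
    exact eLpNorm_leafWidth_le (hg k) hd ht hn hp hε hsum
  · intro f hf
    have hmem : encode n t f K 0 0 0 ∈ hfin.toFinset :=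
      hfin.mem_toFinset.2 (Set.mem_image_of_mem _ hf)
    refine ⟨eq ⟨_, hmem⟩, ?_⟩
    have hcode : encode n t f K 0 0 0 = encode n t (g (eq ⟨_, hmem⟩)) K 0 0 0 := by
      rw [hgk, Equiv.symm_apply_apply]
    have key := fun x => abs_le.1 (abs_sub_leafValue_le hf ht htK hcode x)
    exact ⟨fun x => by linarith [(key x).1], fun x => by linarith [(key x).2]⟩

end Bracket

/-! ### Bracketing entropy -/

lemma lpBracketingEntropy_le {d : ℕ} {F : Set (UnitCube d → ℝ)} {p ε L : ℝ} {m : ℕ}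
    (hm : HasLpBracketing F p ε m) (hL : (m : ℝ) ≤ Real.exp L) :
    lpBracketingEntropy F p ε ≤ (L : EReal) := by
  have h1 : lpBracketingNumber F p ε ≤ (m : ℕ∞) := iInf₂_le m hm
  have h2 : (lpBracketingNumber F p ε : ℝ≥0∞) ≤ ENNReal.ofReal (Real.exp L) := by
    refine (ENat.toENNReal_le.2 h1).trans ?_
    rw [ENat.toENNReal_coe, ← ENNReal.ofReal_natCast]
    exact ENNReal.ofReal_le_ofReal hL
  refine (ENNReal.log_le_log h2).trans ?_
  rw [ENNReal.log_ofReal_of_pos (Real.exp_pos L), Real.log_exp]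

/-! ### Thresholds of slope β and the choice of β -/

/-- The exponents of the thresholds: they decrease up to level `n` and then increase with
slope `β`. -/
noncomputable def thresholdExponent (n : ℕ) (β : ℝ) (k : ℕ) : ℝ :=
  if k ≤ n then -(k : ℝ) else β * ((k : ℝ) - n) - n

/-- The thresholds for the adaptive partitions. -/
noncomputable def threshold (n : ℕ) (β : ℝ) (k : ℕ) : ℝ := (2 : ℝ) ^ thresholdExponent n β k

lemma threshold_pos (n : ℕ) (β : ℝ) (k : ℕ) : 0 < threshold n β k :=
  Real.rpow_pos_of_pos two_pos _

lemma threshold_of_le {n k : ℕ} (β : ℝ) (h : k ≤ n) : threshold n β k = (2 : ℝ) ^ (-(k : ℝ)) := by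
  rw [threshold, thresholdExponent, if_pos h]

lemma threshold_add (n : ℕ) (β : ℝ) (j : ℕ) :
    threshold n β (n + j) = (2 : ℝ) ^ (β * j - n) := by
  rw [threshold, thresholdExponent]
  split_ifs with h
  · obtain rfl : j = 0 := by omega
    simp
  · push_cast
    ring_nf

lemma threshold_le_two_mul {n : ℕ} {β : ℝ} (hβ : 0 < β) (k : ℕ) :
    threshold n β k ≤ 2 * threshold n β (k + 1) := by
  have h : 2 * threshold n β (k + 1) = (2 : ℝ) ^ (1 + thresholdExponent n β (k + 1)) := by
    rw [Real.rpow_add two_pos, Real.rpow_one, threshold]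
  rw [h, threshold]
  apply Real.rpow_le_rpow_of_exponent_le one_le_two
  unfold thresholdExponent
  push_cast
  split_ifs with h1 h2 h2
  · linarith
  · obtain rfl : k = n := by omega
    linarith
  · omega
  · linarith

lemma sum_range_pow_le_pow {x : ℝ} (hx : 2 ≤ x) (n : ℕ) : ∑ k ∈ Finset.range n, x ^ k ≤ x ^ n := by
  induction n with
  | zero => simp
  | succ n ih =>
    rw [Finset.sum_range_succ, pow_succ]
    have : 0 < x ^ n := by positivity
    nlinarith

/-- The bracketing numbers in terms of the parameters of the adaptive partition. -/
lemma exists_hasLpBracketing_of_slope {d : ℕ} (hd : 1 ≤ d) {p : ℝ} (hp : 1 ≤ p) {β : ℝ}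
    (hβ : 0 < β) : ∃ C : ℝ, 1 ≤ C ∧ ∀ (n : ℕ) (ε L : ℝ), 0 ≤ ε →
      C * (2 : ℝ) ^ (-(n * p)) *
        (1 + ∑ j ∈ Finset.range ⌈n / β⌉₊, (2 : ℝ) ^ ((β * (p - 1) - 1) * j)) ≤ ε ^ p →
      C * (2 : ℝ) ^ ((n : ℝ) * d) *
        (1 + ∑ j ∈ Finset.range ⌈n / β⌉₊, (2 : ℝ) ^ (((d : ℝ) - 1 - β) * j)) ≤ L →
      ∃ m : ℕ, HasLpBracketing (monotoneClass d) p ε m ∧ (m : ℝ) ≤ Real.exp L := by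
  set A : ℝ := 4 ^ p * (2 ^ (β * p) * (d * 2 ^ d)) with hA
  set B : ℝ := 2 ^ d * (7 + 9 * (d * 2 ^ d)) with hB
  have hA0 : 0 ≤ A := by positivity
  have hB0 : 0 ≤ B := by positivity
  have h4p : (0 : ℝ) ≤ 4 ^ p := by positivity
  -- One constant serves both conditions: `4 ^ p` and `A` for the norm, `B` and the root's 4 for the
  -- cost.
  refine ⟨4 ^ p + A + B + 4, by linarith, ?_⟩
  intro n ε L hε h1 h2
  set J := ⌈n / β⌉₊ with hJ
  set S1 := ∑ j ∈ Finset.range J, (2 : ℝ) ^ ((β * (p - 1) - 1) * j) with hS1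
  set S2 := ∑ j ∈ Finset.range J, (2 : ℝ) ^ (((d : ℝ) - 1 - β) * j) with hS2
  have hS1n : 0 ≤ S1 := Finset.sum_nonneg fun j _ => by positivity
  have hS2n : 0 ≤ S2 := Finset.sum_nonneg fun j _ => by positivity
  have h2k : ∀ k : ℕ, (2 : ℝ) ^ k = (2 : ℝ) ^ (k : ℝ) := fun k => (Real.rpow_natCast 2 k).symm
  refine exists_hasLpBracketing (n := n) (K := n + J) (t := threshold n β) hd (threshold_pos n β)
    (threshold_le_two_mul hβ) ?_ (Nat.le_add_right n J) ?_ hp hε (le_trans ?_ h1) (le_trans ?_ h2)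
  · rw [threshold_of_le β (Nat.zero_le n)]; simp
  · rw [threshold_add]
    apply Real.one_le_rpow one_le_two
    have : n / β ≤ J := Nat.le_ceil _
    rw [div_le_iff₀ hβ] at this
    linarith
  · rw [Finset.sum_Ico_eq_sum_range, Nat.add_sub_cancel_left]
    have e1 : (4 * threshold n β n) ^ p = 4 ^ p * (2 : ℝ) ^ (-(n * p)) := by
      rw [threshold_of_le β le_rfl, Real.mul_rpow (by norm_num) (by positivity),
        ← Real.rpow_mul two_pos.le]
      ring_nf
    -- The exponents add up as p(β(j+1) - n) - (βj - n) - (n + j) = βp - np + (β(p-1) - 1)j.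
    have e2 : ∀ j : ℕ, (4 * threshold n β (n + j + 1)) ^ p / threshold n β (n + j) *
        (d * 2 ^ d * ((2 : ℝ) ^ (n + j))⁻¹) =
          A * ((2 : ℝ) ^ (-(n * p)) * (2 : ℝ) ^ ((β * (p - 1) - 1) * j)) := by
      intro j
      rw [add_assoc, threshold_add, threshold_add, Real.mul_rpow (by norm_num) (by positivity),
        ← Real.rpow_mul two_pos.le, h2k (n + j), ← Real.rpow_neg two_pos.le, div_eq_mul_inv,
        ← Real.rpow_neg two_pos.le, hA]
      have : ∀ a b c e g h : ℝ, a + b + c = e + (g + h) →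
          (4 : ℝ) ^ p * 2 ^ a * 2 ^ b * (d * 2 ^ d * 2 ^ c) =
            4 ^ p * (2 ^ e * (d * 2 ^ d)) * (2 ^ g * 2 ^ h) := by
        intro a b c e g h hh
        have h3 : (2 : ℝ) ^ a * 2 ^ b * 2 ^ c = 2 ^ e * (2 ^ g * 2 ^ h) := by
          rw [← Real.rpow_add two_pos, ← Real.rpow_add two_pos, ← Real.rpow_add two_pos,
            ← Real.rpow_add two_pos, hh]
        linear_combination (4 : ℝ) ^ p * (d * 2 ^ d) * h3
      apply this
      push_cast
      ring
    rw [e1, Finset.sum_congr rfl fun j _ => e2 j, ← Finset.mul_sum, ← Finset.mul_sum, ← hS1]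
    have h0 : (0 : ℝ) ≤ (2 : ℝ) ^ (-(n * p)) := by positivity
    have h01 := mul_nonneg h0 hS1n
    nlinarith [mul_nonneg h4p h01, mul_nonneg hA0 h0, mul_nonneg hB0 h0, mul_nonneg hB0 h01]
  · rw [Finset.sum_range_add]
    -- Below level `n` the thresholds 2⁻ᵏ make the variation term as large as the number of cells,
    -- 2^{kd}, so the sum is geometric.
    have e1 : ∀ k ∈ Finset.range n, 2 ^ d * ((if k < n then 7 * ((2 : ℝ) ^ k) ^ d else 0) +
        9 * (d * 2 ^ d * ((2 : ℝ) ^ k) ^ (d - 1) / threshold n β k)) = B * ((2 : ℝ) ^ d) ^ k := by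
      intro k hk
      rw [Finset.mem_range] at hk
      have hpow : ((2 : ℝ) ^ k) ^ (d - 1) * 2 ^ k = ((2 : ℝ) ^ k) ^ d := by
        rw [← pow_succ, Nat.sub_add_cancel hd]
      rw [if_pos hk, threshold_of_le β hk.le, Real.rpow_neg two_pos.le, Real.rpow_natCast,
        div_inv_eq_mul, pow_right_comm 2 d k, hB]
      linear_combination 2 ^ d * 9 * (d * 2 ^ d) * hpow
    have e2 : ∀ j : ℕ, 2 ^ d * ((if n + j < n then 7 * ((2 : ℝ) ^ (n + j)) ^ d else 0) +
        9 * (d * 2 ^ d * ((2 : ℝ) ^ (n + j)) ^ (d - 1) / threshold n β (n + j))) =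
          2 ^ d * (9 * (d * 2 ^ d)) * ((2 : ℝ) ^ ((n : ℝ) * d) *
            (2 : ℝ) ^ (((d : ℝ) - 1 - β) * j)) := by
      intro j
      have h3 : ((2 : ℝ) ^ (n + j)) ^ (d - 1) / threshold n β (n + j) =
          (2 : ℝ) ^ ((n : ℝ) * d) * (2 : ℝ) ^ (((d : ℝ) - 1 - β) * j) := by
        rw [threshold_add, ← pow_mul, h2k, ← Real.rpow_sub two_pos, ← Real.rpow_add two_pos]
        congr 1
        push_cast [hd]
        ring
      rw [if_neg (by omega), mul_div_assoc, h3]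
      ring
    rw [Finset.sum_congr rfl e1, Finset.sum_congr rfl fun j _ => e2 j, ← Finset.mul_sum,
      ← Finset.mul_sum, ← Finset.mul_sum, ← hS2]
    have h3 : ∑ k ∈ Finset.range n, ((2 : ℝ) ^ d) ^ k ≤ (2 : ℝ) ^ ((n : ℝ) * d) := by
      have : (2 : ℝ) ^ ((n : ℝ) * d) = ((2 : ℝ) ^ d) ^ n := by
        rw [← pow_mul, h2k]
        push_cast
        ring_nf
      rw [this]
      apply sum_range_pow_le_pow
      calc (2 : ℝ) = 2 ^ 1 := by norm_num
        _ ≤ 2 ^ d := pow_le_pow_right₀ one_le_two hd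
    have h4 : (1 : ℝ) ≤ (2 : ℝ) ^ ((n : ℝ) * d) := Real.one_le_rpow one_le_two (by positivity)
    set X := (2 : ℝ) ^ ((n : ℝ) * d)
    have h5 : 2 ^ d * (9 * (d * 2 ^ d)) ≤ B := by
      rw [hB]
      gcongr
      linarith
    have hX : 0 ≤ X * S2 := mul_nonneg (by linarith) hS2n
    have h6 := mul_le_mul_of_nonneg_left h3 hB0
    have h7 := mul_le_mul_of_nonneg_right h5 hX
    have hX0 : 0 ≤ X := by linarith
    nlinarith [mul_nonneg h4p hX0, mul_nonneg hA0 hX0, mul_nonneg h4p hX, mul_nonneg hA0 hX]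

/-- Geometric sums are dominated by their largest term. -/
lemma exists_geometric_bound {β γ : ℝ} (hβ : 0 < β) (hγ : γ ≠ 0) : ∃ C : ℝ, 1 ≤ C ∧ ∀ n : ℕ,
    1 + ∑ j ∈ Finset.range ⌈n / β⌉₊, (2 : ℝ) ^ (γ * j) ≤ C * 2 ^ ((n : ℝ) * (max γ 0 / β)) := by
  have hconv : ∀ j : ℕ, (2 : ℝ) ^ (γ * j) = ((2 : ℝ) ^ γ) ^ j := fun j => by
    rw [Real.rpow_mul two_pos.le, Real.rpow_natCast]
  have hq0 : (0 : ℝ) < 2 ^ γ := by positivity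
  simp only [hconv]
  rcases hγ.lt_or_gt with h | h
  · have hq : (2 : ℝ) ^ γ < 1 := Real.rpow_lt_one_of_one_lt_of_neg one_lt_two h
    refine ⟨1 + (1 - 2 ^ γ)⁻¹, le_add_of_nonneg_right (inv_nonneg.2 (by linarith)), fun n => ?_⟩
    rw [max_eq_right h.le, zero_div, mul_zero, Real.rpow_zero, mul_one]
    gcongr
    rw [← tsum_geometric_of_lt_one hq0.le hq]
    exact (summable_geometric_of_lt_one hq0.le hq).sum_le_tsum _ fun _ _ => by positivity
  -- Here the sum is of the order of its last term, and the number of terms is at most n/β + 1.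
  · have hq : 1 < (2 : ℝ) ^ γ := Real.one_lt_rpow one_lt_two h
    have hq1 : 0 < (2 : ℝ) ^ γ - 1 := by linarith
    refine ⟨1 + (2 : ℝ) ^ γ / (2 ^ γ - 1), le_add_of_nonneg_right (by positivity), fun n => ?_⟩
    rw [max_eq_left h.le]
    set J := ⌈n / β⌉₊ with hJ
    have hJ' : (J : ℝ) ≤ n / β + 1 := (Nat.ceil_lt_add_one (by positivity)).le
    have h1 : ((2 : ℝ) ^ γ) ^ J ≤ 2 ^ γ * 2 ^ ((n : ℝ) * (γ / β)) := by
      rw [← hconv, ← Real.rpow_add two_pos]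
      apply Real.rpow_le_rpow_of_exponent_le one_le_two
      have := mul_le_mul_of_nonneg_left hJ' h.le
      calc γ * J ≤ γ * (n / β + 1) := this
        _ = _ := by ring
    have h2 : (1 : ℝ) ≤ 2 ^ ((n : ℝ) * (γ / β)) := Real.one_le_rpow one_le_two (by positivity)
    rw [geom_sum_eq hq.ne', add_mul, one_mul]
    refine add_le_add h2 ?_
    rw [div_mul_eq_mul_div]
    gcongr
    linarith

/-- From a geometric sequence of scales to all scales. -/
lemma exists_entropy_bound_of_geometric {d : ℕ} {p a b C : ℝ} (hp : 1 ≤ p) (ha : 0 < a) (hb : 0 < b)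
    (hC : 1 ≤ C) (H : ∀ (n : ℕ) (ε L : ℝ), 0 ≤ ε → C * (2 : ℝ) ^ (-(n * a)) ≤ ε ^ p →
      C * (2 : ℝ) ^ ((n : ℝ) * b) ≤ L →
      ∃ m : ℕ, HasLpBracketing (monotoneClass d) p ε m ∧ (m : ℝ) ≤ Real.exp L) :
    ∃ c : ℝ, 0 < c ∧ ∀ ε : ℝ, 0 < ε → ε < 1 / 2 →
      lpBracketingEntropy (monotoneClass d) p ε ≤ ((c * ε ^ (-(p * b / a)) : ℝ) : EReal) := by
  refine ⟨C * (2 ^ b * C ^ (b / a)), by positivity, fun ε hε hε2 => ?_⟩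
  set y := C * ε ^ (-p) with hy
  have hε1 : 1 ≤ ε ^ (-p) := Real.one_le_rpow_of_pos_of_le_one_of_nonpos hε (by linarith) (by linarith)
  have hy1 : 1 ≤ y := one_le_mul_of_one_le_of_one_le hC hε1
  have hy0 : 0 < y := by linarith
  -- The first scale with C·2^{-na} ≤ ε^p; rounding up costs the factor 2^b.
  set n := ⌈Real.logb 2 y / a⌉₊ with hn
  have hlog : 0 ≤ Real.logb 2 y := Real.logb_nonneg one_lt_two hy1
  have hn1 : Real.logb 2 y / a ≤ n := Nat.le_ceil _
  have hn2 : (n : ℝ) ≤ Real.logb 2 y / a + 1 := (Nat.ceil_lt_add_one (by positivity)).le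
  have hpow : ∀ s : ℝ, (2 : ℝ) ^ (Real.logb 2 y * s) = y ^ s := fun s => by
    rw [Real.rpow_mul two_pos.le, Real.rpow_logb two_pos (by norm_num) hy0]
  obtain ⟨m, hm, hmL⟩ := H n ε (C * (2 : ℝ) ^ ((n : ℝ) * b)) hε.le (by
    have h1 : y ≤ (2 : ℝ) ^ ((n : ℝ) * a) := by
      conv_lhs => rw [← Real.rpow_one y, ← hpow]
      apply Real.rpow_le_rpow_of_exponent_le one_le_two
      rwa [mul_one, ← div_le_iff₀ ha]
    rw [Real.rpow_neg two_pos.le, ← div_eq_mul_inv, div_le_iff₀ (by positivity)]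
    calc C = ε ^ p * y := by
          rw [hy, Real.rpow_neg hε.le]
          have : ε ^ p ≠ 0 := by positivity
          field_simp
      _ ≤ _ := by gcongr) le_rfl
  refine (lpBracketingEntropy_le hm hmL).trans ?_
  rw [EReal.coe_le_coe_iff, mul_assoc]
  gcongr
  calc (2 : ℝ) ^ ((n : ℝ) * b) ≤ 2 ^ (b + Real.logb 2 y * (b / a)) := by
        apply Real.rpow_le_rpow_of_exponent_le one_le_two
        calc (n : ℝ) * b ≤ (Real.logb 2 y / a + 1) * b := by gcongr
          _ = _ := by ring
    _ = 2 ^ b * C ^ (b / a) * ε ^ (-(p * b / a)) := by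
        rw [Real.rpow_add two_pos, hpow, hy, Real.mul_rpow (by linarith) (by positivity),
          ← Real.rpow_mul hε.le, mul_assoc]
        congr 3
        ring

/-- The bracketing entropy away from the critical exponent. -/
lemma exists_lpBracketingEntropy_le {d : ℕ} (hd : 1 ≤ d) {p : ℝ} (hp : 1 ≤ p)
    (hpd : ((d : ℝ) - 1) * p ≠ d) : ∃ c : ℝ, 0 < c ∧ ∀ ε : ℝ, 0 < ε → ε < 1 / 2 →
      lpBracketingEntropy (monotoneClass d) p ε ≤
        ((c * ε ^ (-(max (d : ℝ) (((d : ℝ) - 1) * p))) : ℝ) : EReal) := by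
  have hd1 : (1 : ℝ) ≤ d := by exact_mod_cast hd
  obtain ⟨β, hβ, h1, h2, hexp⟩ : ∃ β : ℝ, 0 < β ∧ β * (p - 1) - 1 ≠ 0 ∧ (d : ℝ) - 1 - β ≠ 0 ∧
      ∃ a b : ℝ, 0 < a ∧ 0 < b ∧ a = p - max (β * (p - 1) - 1) 0 / β ∧
        b = d + max ((d : ℝ) - 1 - β) 0 / β ∧ p * b / a = max (d : ℝ) (((d : ℝ) - 1) * p) := by
    rcases hpd.lt_or_gt with h | h
    -- Subcritical case: d - 1 < 1/(p-1), and a β in between makes both exponents negative. For p =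
    -- 1 there is no upper constraint, and β = d will do.
    · obtain ⟨β, hβ0, hβ1, hβ2⟩ : ∃ β : ℝ, 0 < β ∧ (d : ℝ) - 1 < β ∧ β * (p - 1) < 1 := by
        rcases hp.eq_or_lt with rfl | hp1
        · exact ⟨d, by linarith, by linarith, by simp⟩
        · have : (d : ℝ) - 1 < 1 / (p - 1) := by
            rw [lt_div_iff₀ (by linarith)]; nlinarith
          obtain ⟨β, hb1, hb2⟩ := exists_between this
          exact ⟨β, by linarith, hb1, by rwa [lt_div_iff₀ (by linarith)] at hb2⟩
      refine ⟨β, hβ0, by linarith, by linarith, p, d, by linarith, by linarith, ?_, ?_, ?_⟩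
      · rw [max_eq_right (by linarith)]; simp
      · rw [max_eq_right (by linarith)]; simp
      · rw [max_eq_left h.le]
        field_simp
    -- Supercritical case: 1/(p-1) < β < d - 1 makes both exponents positive. Then b = (d-1)a, so β
    -- drops out of pb/a.
    · have hp1 : 1 < p := by
        rcases hp.eq_or_lt with rfl | hp1
        · linarith
        · exact hp1
      have : 1 / (p - 1) < (d : ℝ) - 1 := by
        rw [div_lt_iff₀ (by linarith)]; nlinarith
      obtain ⟨β, hb1, hb2⟩ := exists_between this
      have hβ0 : 0 < β := lt_trans (by have := sub_pos.2 hp1; positivity) hb1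
      rw [div_lt_iff₀ (by linarith)] at hb1
      have hd2 : 0 < (d : ℝ) - 1 := by linarith
      refine ⟨β, hβ0, by linarith, by linarith, 1 + 1 / β, ((d : ℝ) - 1) * (1 + 1 / β),
        by positivity, by positivity, ?_, ?_, ?_⟩
      · rw [max_eq_left (by linarith)]
        field_simp
        ring
      · rw [max_eq_left (by linarith)]
        field_simp
        ring
      · rw [max_eq_right h.le]
        have : 1 + 1 / β ≠ 0 := by positivity
        field_simp
  obtain ⟨a, b, ha, hb, hae, hbe, hab⟩ := hexp
  obtain ⟨C0, hC0, H⟩ := exists_hasLpBracketing_of_slope hd hp hβ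
  obtain ⟨C1, hC1, H1⟩ := exists_geometric_bound hβ h1
  obtain ⟨C2, hC2, H2⟩ := exists_geometric_bound hβ h2
  rw [← hab]
  refine exists_entropy_bound_of_geometric (C := C0 * (C1 * C2)) hp ha hb
    (one_le_mul_of_one_le_of_one_le hC0 (one_le_mul_of_one_le_of_one_le hC1 hC2)) ?_
  intro n ε L hε hεn hL
  refine H n ε L hε (le_trans ?_ hεn) (le_trans ?_ hL)
  · calc _ ≤ C0 * (2 : ℝ) ^ (-(n * p)) *
          (C1 * C2 * 2 ^ ((n : ℝ) * (max (β * (p - 1) - 1) 0 / β))) := by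
          gcongr
          refine (H1 n).trans ?_
          gcongr
          exact le_mul_of_one_le_right (by linarith) hC2
      _ = C0 * (C1 * C2) * ((2 : ℝ) ^ (-(n * p)) *
          2 ^ ((n : ℝ) * (max (β * (p - 1) - 1) 0 / β))) := by ring
      _ = _ := by
          rw [← Real.rpow_add two_pos, hae]
          ring_nf
  · calc _ ≤ C0 * (2 : ℝ) ^ ((n : ℝ) * d) *
          (C1 * C2 * 2 ^ ((n : ℝ) * (max ((d : ℝ) - 1 - β) 0 / β))) := by
          gcongr
          refine (H2 n).trans ?_
          gcongr
          exact le_mul_of_one_le_left (by linarith) hC1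
      _ = C0 * (C1 * C2) * ((2 : ℝ) ^ ((n : ℝ) * d) *
          2 ^ ((n : ℝ) * (max ((d : ℝ) - 1 - β) 0 / β))) := by ring
      _ = _ := by
          rw [← Real.rpow_add two_pos, hbe]
          ring_nf

/-- In the critical case `N` extra levels gain a factor 2^N in the norm, while the number of terms
grows only linearly in `N`. -/
lemma exists_mul_add_le_two_pow (A B : ℝ) : ∃ N : ℕ, A + B * N ≤ (2 : ℝ) ^ N := by
  have h1 := tendsto_pow_const_div_const_pow_of_one_lt 1 (one_lt_two (α := ℝ))
  have h0 := tendsto_pow_const_div_const_pow_of_one_lt 0 (one_lt_two (α := ℝ))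
  have h := (h0.const_mul A).add (h1.const_mul B)
  rw [mul_zero, mul_zero, add_zero] at h
  obtain ⟨N, hN⟩ := (h.eventually_lt_const one_pos).exists
  refine ⟨N, ?_⟩
  have h2 : (0 : ℝ) < 2 ^ N := by positivity
  rw [pow_zero, pow_one, mul_div_assoc', mul_div_assoc', mul_one, ← add_div, div_lt_one h2] at hN
  exact hN.le

/-- The bracketing entropy at the critical exponent. -/
lemma exists_lpBracketingEntropy_le_critical {d : ℕ} (hd : 1 ≤ d) {p : ℝ} (hp : 1 ≤ p)
    (hpd : ((d : ℝ) - 1) * p = d) : ∃ c : ℝ, 0 < c ∧ ∀ ε : ℝ, 0 < ε → ε < 1 / 2 →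
      lpBracketingEntropy (monotoneClass d) p ε ≤
        ((c * ε ^ (-(d : ℝ)) * (Real.log (1 / ε)) ^ (1 + (d : ℝ) / p) : ℝ) : EReal) := by
  have hd1 : (1 : ℝ) ≤ d := by exact_mod_cast hd
  have hp0 : 0 < p := by linarith
  have hβ : 0 < (d : ℝ) - 1 := by
    by_contra hneg
    have : ((d : ℝ) - 1) * p ≤ 0 := mul_nonpos_of_nonpos_of_nonneg (not_lt.1 hneg) hp0.le
    linarith
  obtain ⟨C, hC, H⟩ := exists_hasLpBracketing_of_slope hd hp hβ
  have hβ1 : ((d : ℝ) - 1) * (p - 1) - 1 = 0 := by linarith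
  have hJ : ∀ n : ℕ, 1 + (⌈n / ((d : ℝ) - 1)⌉₊ : ℝ) ≤ n + 1 := by
    intro n
    have hd2 : 1 ≤ (d : ℝ) - 1 := by
      have : 1 < d := by
        have : (1 : ℝ) < d := by linarith
        exact_mod_cast this
      have : (2 : ℝ) ≤ d := by exact_mod_cast this
      linarith
    have : ⌈n / ((d : ℝ) - 1)⌉₊ ≤ n := Nat.ceil_le.2 (div_le_self (by positivity) hd2)
    have : (⌈n / ((d : ℝ) - 1)⌉₊ : ℝ) ≤ n := by exact_mod_cast this
    linarith
  simp only [hβ1, sub_self, zero_mul, Real.rpow_zero, Finset.sum_const, Finset.card_range,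
    nsmul_eq_mul, mul_one] at H
  obtain ⟨N, hN⟩ := exists_mul_add_le_two_pow (C * 8) (C * 2)
  refine ⟨C * (2 ^ ((N + 1 : ℝ) * d) * (8 + 2 * N)), by positivity, fun ε hε hε2 => ?_⟩
  set l := Real.log (1 / ε) with hl
  have hlog2 := Real.log_two_gt_d9
  have hεi : 2 < 1 / ε := by
    rw [lt_div_iff₀ hε]; linarith
  have hl2 : 1 / 2 ≤ l := by
    have := Real.log_le_log two_pos hεi.le
    linarith
  have hl0 : 0 < l := by linarith
  -- With n of order l, the condition n·2^{-np} ≤ ε^p asks for 2^n of order ε⁻¹ l^{1/p}.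
  set y := 1 / ε * l ^ (1 / p) with hy
  have hlp : 1 / 2 ≤ l ^ (1 / p) := by
    have hp1 : 1 / p ≤ 1 := by rw [div_le_one hp0]; exact hp
    calc (1 / 2 : ℝ) = (1 / 2) ^ (1 : ℝ) := by rw [Real.rpow_one]
      _ ≤ (1 / 2 : ℝ) ^ (1 / p) :=
        Real.rpow_le_rpow_of_exponent_ge (by norm_num) (by norm_num) hp1
      _ ≤ _ := Real.rpow_le_rpow (by norm_num) hl2 (by positivity)
  have hy1 : 1 ≤ y := by
    rw [hy]; nlinarith
  have hy0 : 0 < y := by linarith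
  have hlogy : Real.logb 2 y ≤ 4 * l := by
    have h1 : Real.log y ≤ 2 * l := by
      rw [hy, Real.log_mul (by positivity) (by positivity), Real.log_rpow hl0]
      have h2 : Real.log l ≤ l := by have := Real.log_le_sub_one_of_pos hl0; linarith
      have h3 : 1 / p * Real.log l ≤ 1 / p * l := by gcongr
      have h4 : 1 / p * l ≤ l := by
        apply mul_le_of_le_one_left hl0.le
        rw [div_le_one hp0]; exact hp
      linarith
    rw [Real.logb, div_le_iff₀ (by linarith)]
    nlinarith
  set k := ⌈Real.logb 2 y⌉₊ with hk
  have hk1 : Real.logb 2 y ≤ k := Nat.le_ceil _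
  have hk2 : (k : ℝ) ≤ Real.logb 2 y + 1 :=
    (Nat.ceil_lt_add_one (Real.logb_nonneg one_lt_two hy1)).le
  set n := k + N with hn
  have hn1 : (n : ℝ) + 1 ≤ (8 + 2 * N) * l := by
    have : (N : ℝ) ≤ 2 * N * l := by
      have : (0 : ℝ) ≤ N := Nat.cast_nonneg N
      nlinarith
    rw [hn]
    push_cast
    linarith
  have hpow : (2 : ℝ) ^ Real.logb 2 y = y := Real.rpow_logb two_pos (by norm_num) hy0
  have hyk : y ≤ (2 : ℝ) ^ (k : ℝ) := by
    conv_lhs => rw [← hpow]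
    exact Real.rpow_le_rpow_of_exponent_le one_le_two hk1
  have hkn : (2 : ℝ) ^ (n : ℝ) ≤ 2 ^ (N + 1 : ℝ) * y := by
    conv_rhs => rw [← hpow, ← Real.rpow_add two_pos]
    apply Real.rpow_le_rpow_of_exponent_le one_le_two
    rw [hn]
    push_cast
    linarith
  obtain ⟨m, hm, hmL⟩ := H n ε _ hε.le (by
    have h1 : (2 : ℝ) ^ N * y ≤ 2 ^ (n : ℝ) := by
      rw [hn, Nat.cast_add, Real.rpow_add two_pos, Real.rpow_natCast 2 N, mul_comm]
      gcongr
    have h2 : (2 : ℝ) ^ N * (ε ^ (-p) * l) ≤ 2 ^ (n * p) := by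
      calc (2 : ℝ) ^ N * (ε ^ (-p) * l) ≤ ((2 : ℝ) ^ N) ^ p * (ε ^ (-p) * l) := by
            gcongr
            conv_lhs => rw [← Real.rpow_one ((2 : ℝ) ^ N)]
            exact Real.rpow_le_rpow_of_exponent_le (one_le_pow₀ one_le_two) hp
        _ = ((2 : ℝ) ^ N * y) ^ p := by
            rw [Real.mul_rpow (by positivity) hy0.le, hy, Real.mul_rpow (by positivity) (by positivity),
              ← Real.rpow_mul hl0.le, one_div_mul_cancel hp0.ne', Real.rpow_one, one_div,
              Real.inv_rpow hε.le, Real.rpow_neg hε.le]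
        _ ≤ ((2 : ℝ) ^ (n : ℝ)) ^ p := by gcongr
        _ = _ := by rw [← Real.rpow_mul two_pos.le]
    have h3 : C * (1 + (⌈n / ((d : ℝ) - 1)⌉₊ : ℝ)) ≤ 2 ^ N * l := by
      calc C * (1 + (⌈n / ((d : ℝ) - 1)⌉₊ : ℝ)) ≤ C * ((8 + 2 * N) * l) := by
            gcongr
            exact (hJ n).trans hn1
        _ = (C * 8 + C * 2 * N) * l := by ring
        _ ≤ _ := by gcongr
    rw [Real.rpow_neg two_pos.le, mul_right_comm, ← div_eq_mul_inv, div_le_iff₀ (by positivity)]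
    calc _ ≤ 2 ^ N * l := h3
      _ = ε ^ p * (2 ^ N * (ε ^ (-p) * l)) := by
          rw [Real.rpow_neg hε.le]
          have : ε ^ p ≠ 0 := by positivity
          field_simp
      _ ≤ _ := by gcongr) le_rfl
  refine (lpBracketingEntropy_le hm hmL).trans ?_
  rw [EReal.coe_le_coe_iff]
  calc _ ≤ C * ((2 : ℝ) ^ (N + 1 : ℝ) * y) ^ (d : ℝ) * ((8 + 2 * N) * l) := by
        rw [Real.rpow_mul two_pos.le]
        gcongr
        exact (hJ n).trans hn1
    _ = _ := by
        rw [Real.mul_rpow (by positivity) hy0.le, ← Real.rpow_mul two_pos.le, hy,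
          Real.mul_rpow (by positivity) (by positivity), ← Real.rpow_mul hl0.le, one_div_mul_eq_div,
          one_div, Real.inv_rpow hε.le, Real.rpow_neg hε.le, Real.rpow_add hl0, Real.rpow_one]
        ring

/-! ### Covering and bracketing numbers -/

/-- The lower ends of the brackets serve as centres; the comparison of norms is pointwise and needs
no measurability of `f`. -/
lemma HasLpBracketing.hasLpCover {d : ℕ} {F : Set (UnitCube d → ℝ)} {p ε : ℝ} {m : ℕ}
    (h : HasLpBracketing F p ε m) : HasLpCover F p ε m := by
  obtain ⟨l, u, hlu, hF⟩ := h
  refine ⟨l, fun k => (hlu k).1, fun f hf => ?_⟩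
  obtain ⟨k, h1, h2⟩ := hF f hf
  refine ⟨k, le_trans (eLpNorm_mono fun x => ?_) (hlu k).2.2⟩
  have h1x := h1 x
  have h2x := h2 x
  simp only [Pi.sub_apply, Real.norm_eq_abs]
  rw [abs_of_nonneg (by linarith), abs_of_nonneg (by linarith)]
  linarith

lemma lpEntropy_le_lpBracketingEntropy {d : ℕ} (F : Set (UnitCube d → ℝ)) (p ε : ℝ) :
    lpEntropy F p ε ≤ lpBracketingEntropy F p ε :=
  ENNReal.log_le_log (ENat.toENNReal_le.2
    (le_iInf₂ fun m hm => iInf₂_le m hm.hasLpCover))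

lemma le_lpEntropy {d : ℕ} {F : Set (UnitCube d → ℝ)} {p ε L : ℝ}
    (h : ∀ m : ℕ, HasLpCover F p ε m → Real.exp L ≤ m) : (L : EReal) ≤ lpEntropy F p ε := by
  have h2 : ENNReal.ofReal (Real.exp L) ≤ (lpCoveringNumber F p ε : ℝ≥0∞) := by
    rcases eq_or_ne (lpCoveringNumber F p ε) ⊤ with htop | htop
    · rw [htop]; simp
    · obtain ⟨m, hm, hme⟩ : ∃ m : ℕ, HasLpCover F p ε m ∧ lpCoveringNumber F p ε = m := by
        have hex : ∃ m, HasLpCover F p ε m := by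
          by_contra hno
          push Not at hno
          exact htop (by simp [lpCoveringNumber, hno])
        classical
        refine ⟨Nat.find hex, Nat.find_spec hex, le_antisymm (iInf₂_le _ (Nat.find_spec hex)) ?_⟩
        exact le_iInf₂ fun m hm => by exact_mod_cast Nat.find_min' hex hm
      rw [hme, ENat.toENNReal_coe, ← ENNReal.ofReal_natCast]
      exact ENNReal.ofReal_le_ofReal (h m hm)
  rw [← Real.log_exp L, ← ENNReal.log_ofReal_of_pos (Real.exp_pos L)]
  exact ENNReal.log_le_log h2

/-! ### Packings by step functions -/

open Classical in
/-- A step function whose value on a dyadic cell depends on the sum of the indices of the cell, and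
on whether the cell belongs to `s`. -/
noncomputable def stepFunction {d : ℕ} (k : ℕ) (a b : ℕ → ℝ) (s : Finset (Fin d → ℕ))
    (x : UnitCube d) : ℝ :=
  if cellIndex k x ∈ s then b (∑ i, cellIndex k x i) else a (∑ i, cellIndex k x i)

/-- Moving up along an axis either stays in the cell or increases the index sum, and `b j ≤ a (j +
1)` then prevents any decrease, whatever `s` is. -/
lemma stepFunction_mem_monotoneClass {d k : ℕ} {a b : ℕ → ℝ} (h0 : ∀ j, 0 ≤ a j)
    (hab : ∀ j, a j ≤ b j) (hba : ∀ j, b j ≤ a (j + 1)) (h1 : ∀ j ≤ d * 2 ^ k, b j ≤ 1)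
    (s : Finset (Fin d → ℕ)) : stepFunction k a b s ∈ monotoneClass d := by
  classical
  have ha : Monotone a := monotone_nat_of_le_succ fun j => (hab j).trans (hba j)
  have hs : ∀ x : UnitCube d, a (∑ i, cellIndex k x i) ≤ stepFunction k a b s x ∧
      stepFunction k a b s x ≤ b (∑ i, cellIndex k x i) := by
    intro x
    unfold stepFunction
    split_ifs
    · exact ⟨hab _, le_rfl⟩
    · exact ⟨le_rfl, hab _⟩
  refine ⟨fun x => ⟨(h0 _).trans (hs x).1, (hs x).2.trans (h1 _ ?_)⟩, fun x i => Or.inl ?_⟩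
  · calc ∑ i, cellIndex k x i ≤ ∑ _i : Fin d, 2 ^ k :=
          Finset.sum_le_sum fun i _ => (dyadicIndex_lt k (x i)).le
      _ = d * 2 ^ k := by simp
  · intro u v huv
    set x1 := Function.update x i u
    set x2 := Function.update x i v
    have hx : x1 ≤ x2 := update_le_update_iff'.2 huv
    have hc : cellIndex k x1 ≤ cellIndex k x2 := fun j => dyadicIndex_mono k (hx j)
    change stepFunction k a b s x1 ≤ stepFunction k a b s x2
    rcases hc.eq_or_lt with he | hlt
    · unfold stepFunction
      rw [he]
    · have hsum : ∑ j, cellIndex k x1 j < ∑ j, cellIndex k x2 j := by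
        obtain ⟨hle, j, hj⟩ := Pi.lt_def.1 hlt
        exact Finset.sum_lt_sum (fun j _ => hle j) ⟨j, Finset.mem_univ j, hj⟩
      exact (hs x1).2.trans ((hba _).trans ((ha hsum).trans (hs x2).1))

lemma measurable_stepFunction {d : ℕ} (k : ℕ) (a b : ℕ → ℝ) (s : Finset (Fin d → ℕ)) :
    Measurable (stepFunction k a b s) := by
  classical
  exact (Measurable.of_discrete (f := fun c : Fin d → ℕ =>
    if c ∈ s then b (∑ i, c i) else a (∑ i, c i))).comp (measurable_cellIndex k)

/-- The distance of two step functions, in terms of the Hamming distance. -/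
lemma le_eLpNorm_stepFunction_sub {d k : ℕ} {a b : ℕ → ℝ} {h p : ℝ} (hp : 1 ≤ p) (hh : 0 < h)
    {S : Finset (Fin d → ℕ)} (hS : S ⊆ cells d k)
    (hgap : ∀ c ∈ S, a (∑ i, c i) + h ≤ b (∑ i, c i)) {s s' : Finset (Fin d → ℕ)} (hs : s ⊆ S)
    (hs' : s' ⊆ S) :
    ENNReal.ofReal (h ^ p * ((symmDiff s s').card * ((2 : ℝ) ^ k)⁻¹ ^ d)) ≤
      eLpNorm (stepFunction k a b s - stepFunction k a b s') (ENNReal.ofReal p) volume ^ p := by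
  classical
  have hp0 : 0 < p := by linarith
  have hsd : symmDiff s s' ⊆ S := fun c hc => by
    rcases Finset.mem_symmDiff.1 hc with h | h
    · exact hs h.1
    · exact hs' h.1
  have hm : AEStronglyMeasurable (stepFunction k a b s - stepFunction k a b s') volume :=
    ((measurable_stepFunction k a b s).sub (measurable_stepFunction k a b s')).aestronglyMeasurable
  -- Chebyshev's inequality on the cells of the symmetric difference, where the two functions differ
  -- by at least `h`.
  have key := mul_meas_ge_le_pow_eLpNorm (p := ENNReal.ofReal p) volume (by simpa using hp0)
    ENNReal.ofReal_ne_top hm (ENNReal.ofReal (h ^ p))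
  rw [ENNReal.toReal_ofReal hp0.le] at key
  refine le_trans ?_ key
  rw [ENNReal.ofReal_mul (by positivity), ← volume_cellIndex_preimage (hsd.trans hS)]
  refine mul_le_mul_right (measure_mono fun x hx => ?_) _
  have hx' : cellIndex k x ∈ symmDiff s s' := hx
  change ENNReal.ofReal (h ^ p) ≤ ‖stepFunction k a b s x - stepFunction k a b s' x‖ₑ ^ p
  have hle : h ≤ |stepFunction k a b s x - stepFunction k a b s' x| := by
    have hg := hgap _ (hsd hx')
    unfold stepFunction
    rcases Finset.mem_symmDiff.1 hx' with hh | hh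
    · rw [if_pos hh.1, if_neg hh.2]
      exact le_trans (by linarith) (le_abs_self _)
    · rw [if_pos hh.1, if_neg hh.2, abs_sub_comm]
      exact le_trans (by linarith) (le_abs_self _)
  rw [Real.enorm_eq_ofReal_abs, ENNReal.ofReal_rpow_of_nonneg (abs_nonneg _) hp0.le]
  apply ENNReal.ofReal_le_ofReal
  gcongr

/-- A family of subsets of `S` with pairwise Hamming distances at most `|S| / 8` is small. -/
lemma card_le_of_symmDiff_le {α : Type*} [DecidableEq α] {S : Finset α} {G : Finset (Finset α)}
    (hG : ∀ s ∈ G, s ⊆ S) (hdist : ∀ s ∈ G, ∀ s' ∈ G, 8 * (symmDiff s s').card ≤ S.card) :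
    (G.card : ℝ) ≤ (3 / 2) ^ S.card := by
  rcases G.eq_empty_or_nonempty with rfl | ⟨s0, hs0⟩
  · simp
    positivity
  · have hinj : Set.InjOn (fun s => symmDiff s s0) (G : Set (Finset α)) := fun s _ s' _ h =>
      symmDiff_left_injective s0 h
    -- Translation by `s0` moves the family into a Hamming ball about ∅. There the Chernoff weight
    -- (6/5)^{|S| - 8|u|} is at least 1, and (6/5)(1 + (5/6)^8) < 3/2.
    calc (G.card : ℝ) = ∑ u ∈ G.image fun s => symmDiff s s0, (1 : ℝ) := by
          rw [Finset.sum_const, Finset.card_image_of_injOn hinj]; simp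
      _ ≤ ∑ u ∈ G.image fun s => symmDiff s s0, (6 / 5 : ℝ) ^ S.card * ((5 / 6) ^ 8) ^ u.card := by
          refine Finset.sum_le_sum fun u hu => ?_
          obtain ⟨s, hs, rfl⟩ := Finset.mem_image.1 hu
          have hle := hdist s hs s0 hs0
          rw [← pow_mul, ← inv_div, inv_pow, ← div_eq_inv_mul, one_le_div (by positivity)]
          exact pow_le_pow_of_le_one (by norm_num) (by norm_num) hle
      _ ≤ ∑ u ∈ S.powerset, (6 / 5 : ℝ) ^ S.card * ((5 / 6) ^ 8) ^ u.card := by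
          refine Finset.sum_le_sum_of_subset_of_nonneg ?_ fun _ _ _ => by positivity
          intro u hu
          obtain ⟨s, hs, rfl⟩ := Finset.mem_image.1 hu
          rw [Finset.mem_powerset]
          intro c hc
          rcases Finset.mem_symmDiff.1 hc with h | h
          · exact hG s hs h.1
          · exact hG s0 hs0 h.1
      _ = (6 / 5 : ℝ) ^ S.card * ((5 / 6) ^ 8 + 1) ^ S.card := by
          rw [← Finset.mul_sum, ← Finset.sum_pow_mul_eq_add_pow]
          simp
      _ ≤ (3 / 2) ^ S.card := by
          rw [← mul_pow]
          gcongr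
          norm_num

/-- The packing bound for the entropy. -/
lemma le_lpEntropy_of_cells {d k : ℕ} {a b : ℕ → ℝ} {h p ε : ℝ} (hp : 1 ≤ p) (hh : 0 < h)
    (hε : 0 < ε) (h0 : ∀ j, 0 ≤ a j) (hab : ∀ j, a j ≤ b j) (hba : ∀ j, b j ≤ a (j + 1))
    (h1 : ∀ j ≤ d * 2 ^ k, b j ≤ 1) {S : Finset (Fin d → ℕ)} (hS : S ⊆ cells d k)
    (hgap : ∀ c ∈ S, a (∑ i, c i) + h ≤ b (∑ i, c i))
    (hsep : ∀ N : ℕ, S.card < 8 * N → (2 * ε) ^ p < h ^ p * (N * ((2 : ℝ) ^ k)⁻¹ ^ d)) :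
    ((S.card / 4 : ℝ) : EReal) ≤ lpEntropy (monotoneClass d) p ε := by
  classical
  have hp0 : 0 < p := by linarith
  refine le_lpEntropy fun m hm => ?_
  obtain ⟨g, hg, hF⟩ := hm
  have hcov : ∀ s : Finset (Fin d → ℕ), ∃ j, eLpNorm (stepFunction k a b s - g j)
      (ENNReal.ofReal p) volume ≤ ENNReal.ofReal ε := fun s =>
    hF _ (stepFunction_mem_monotoneClass h0 hab hba h1 s)
  choose φ hφ using hcov
  -- Functions in a common ball are within 2ε, so their sets are within |S|/8. A ball thus serves at
  -- most (3/2)^{|S|} of the 2^{|S|} sets, and m ≥ (4/3)^{|S|} ≥ e^{|S|/4}.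
  have hfib : ∀ j : Fin m, ((S.powerset.filter fun s => φ s = j).card : ℝ) ≤ (3 / 2) ^ S.card := by
    intro j
    refine card_le_of_symmDiff_le (fun s hs => Finset.mem_powerset.1 (Finset.mem_filter.1 hs).1) ?_
    intro s hs s' hs'
    rw [Finset.mem_filter, Finset.mem_powerset] at hs hs'
    by_contra hlt
    have h2 := hsep _ (not_le.1 hlt)
    have h3 := le_eLpNorm_stepFunction_sub hp hh hS hgap hs.1 hs'.1
    have h4 : eLpNorm (stepFunction k a b s - stepFunction k a b s') (ENNReal.ofReal p) volume ≤
        ENNReal.ofReal (2 * ε) := by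
      have hsub : stepFunction k a b s - stepFunction k a b s' =
          (stepFunction k a b s - g j) - (stepFunction k a b s' - g j) := by
        abel
      have hmeas : ∀ s, AEStronglyMeasurable (stepFunction k a b s - g j) volume := fun s =>
        (measurable_stepFunction k a b s).aestronglyMeasurable.sub (hg j).1
      have e1 := hφ s
      have e2 := hφ s'
      rw [hs.2] at e1
      rw [hs'.2] at e2
      rw [hsub]
      refine (eLpNorm_sub_le (hmeas s) (hmeas s') (by simpa using hp)).trans ?_
      rw [two_mul, ENNReal.ofReal_add hε.le hε.le]
      exact add_le_add e1 e2
    have h5 := h3.trans (ENNReal.rpow_le_rpow h4 hp0.le)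
    rw [ENNReal.ofReal_rpow_of_nonneg (by linarith) hp0.le,
      ENNReal.ofReal_le_ofReal_iff (by positivity)] at h5
    linarith
  have hcount : (2 : ℝ) ^ S.card ≤ m * (3 / 2) ^ S.card := by
    calc (2 : ℝ) ^ S.card = (S.powerset.card : ℝ) := by simp
      _ = ∑ j : Fin m, ((S.powerset.filter fun s => φ s = j).card : ℝ) := by
          exact_mod_cast Finset.card_eq_sum_card_fiberwise fun s _ => Finset.mem_univ (φ s)
      _ ≤ ∑ _j : Fin m, (3 / 2 : ℝ) ^ S.card := Finset.sum_le_sum fun j _ => hfib j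
      _ = _ := by simp
  have h43 : (4 / 3 : ℝ) ^ S.card ≤ m := by
    have : (4 / 3 : ℝ) ^ S.card * (3 / 2) ^ S.card ≤ m * (3 / 2) ^ S.card := by
      rw [← mul_pow]
      norm_num
      exact hcount
    exact le_of_mul_le_mul_right this (by positivity)
  refine le_trans ?_ h43
  have hexp : Real.exp (1 / 4) ≤ 4 / 3 := by
    have h6 := Real.add_one_le_exp (-(1 / 4) : ℝ)
    rw [Real.exp_neg] at h6
    have h7 : (3 / 4 : ℝ) ≤ (Real.exp (1 / 4))⁻¹ := by linarith
    calc Real.exp (1 / 4) = ((Real.exp (1 / 4))⁻¹)⁻¹ := (inv_inv _).symm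
      _ ≤ (3 / 4 : ℝ)⁻¹ := inv_anti₀ (by norm_num) h7
      _ = 4 / 3 := by norm_num
  calc Real.exp (S.card / 4) = Real.exp (1 / 4) ^ S.card := by
        rw [← Real.exp_nat_mul]
        ring_nf
    _ ≤ _ := by gcongr

/-! ### Lower bounds for the entropy -/

/-- The constants 0 and 1 are at distance 1 > 2ε. This covers those ε for which no grid is
admissible in the finer constructions. -/
lemma quarter_le_lpEntropy {d : ℕ} {p ε : ℝ} (hp : 1 ≤ p) (hε : 0 < ε) (hε2 : ε < 1 / 2) :
    ((1 / 4 : ℝ) : EReal) ≤ lpEntropy (monotoneClass d) p ε := by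
  have hcell : (cells d 0).card = 1 := by rw [card_cells]; simp
  have h := le_lpEntropy_of_cells (d := d) (k := 0) (a := fun j => if 0 < j then 1 else 0)
    (b := fun _ => 1) (h := 1) hp one_pos hε (fun j => by split_ifs <;> norm_num)
    (fun j => by split_ifs <;> norm_num) (fun j => by simp) (fun _ _ => le_rfl)
    (S := cells d 0) subset_rfl (fun c hc => by
      have : ∀ i, c i = 0 := fun i => by
        have := mem_cells.1 hc i
        simp only [pow_zero] at this
        omega
      simp [this]) (fun N hN => by
      rw [hcell] at hN
      have hN1 : (1 : ℝ) ≤ N := by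
        have : 1 ≤ N := by omega
        exact_mod_cast this
      simp only [Real.one_rpow, pow_zero, inv_one, one_pow, mul_one, one_mul]
      refine lt_of_lt_of_le ?_ hN1
      exact Real.rpow_lt_one (by linarith) (by linarith) (by linarith))
  rwa [hcell, Nat.cast_one] at h

/-- Perturbations of a linear function. -/
lemma pow_le_lpEntropy {d : ℕ} (hd : 1 ≤ d) {p ε : ℝ} (hp : 1 ≤ p) (hε : 0 < ε) {k : ℕ}
    (hk : 32 * d * (2 : ℝ) ^ k * ε ≤ 1) :
    ((((2 : ℝ) ^ k) ^ d / 4 : ℝ) : EReal) ≤ lpEntropy (monotoneClass d) p ε := by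
  have hp0 : 0 < p := by linarith
  have hd0 : (1 : ℝ) ≤ d := by exact_mod_cast hd
  -- The factor 2 keeps (j + 1)/D ≤ 1 up to j = d·2^k.
  set D : ℝ := 2 * d * 2 ^ k with hD
  have hk1 : (1 : ℝ) ≤ 2 ^ k := one_le_pow₀ one_le_two
  have hD0 : 0 < D := by positivity
  have h := le_lpEntropy_of_cells (d := d) (k := k) (a := fun j => (j : ℝ) / D)
    (b := fun j => ((j : ℝ) + 1) / D) (h := 1 / D) hp (by positivity) hε (fun j => by positivity)
    (fun j => by
      gcongr
      linarith) (fun j => by push_cast; exact le_rfl) (fun j hj => by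
      rw [div_le_one hD0]
      have : (j : ℝ) ≤ d * 2 ^ k := by exact_mod_cast hj
      nlinarith)
    (S := cells d k) subset_rfl (fun c _ => by rw [← add_div]) (fun N hN => by
      rw [card_cells] at hN
      have hN' : ((2 : ℝ) ^ k) ^ d < 8 * N := by exact_mod_cast hN
      have hpos : (0 : ℝ) < (2 ^ k) ^ d := by positivity
      have h8 : (1 / 8 : ℝ) < N * ((2 : ℝ) ^ k)⁻¹ ^ d := by
        rw [inv_pow, ← div_eq_mul_inv, lt_div_iff₀ hpos]
        linarith
      -- Separation on more than an eighth of the cube requires (2ε)^p ≤ D^{-p}/8, for which 2ε ≤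
      -- 1/(8D) suffices; this is the constant 32.
      have h1 : 2 * ε ≤ 1 / D * (1 / 8) := by
        rw [← mul_le_mul_iff_right₀ hD0]
        have : D * (1 / D * (1 / 8)) = 1 / 8 := by field_simp
        rw [this, hD]
        linarith
      calc (2 * ε) ^ p ≤ (1 / D * (1 / 8)) ^ p := by gcongr
        _ = (1 / D) ^ p * (1 / 8) ^ p := Real.mul_rpow (by positivity) (by norm_num)
        _ ≤ (1 / D) ^ p * (1 / 8) := by
            gcongr
            calc (1 / 8 : ℝ) ^ p ≤ (1 / 8) ^ (1 : ℝ) :=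
                  Real.rpow_le_rpow_of_exponent_ge (by norm_num) (by norm_num) hp
              _ = _ := Real.rpow_one _
        _ < _ := by gcongr)
  rw [card_cells] at h
  exact_mod_cast h

/-- Some antidiagonal contains many cells. -/
lemma exists_antidiagonal_card {d : ℕ} (hd : 1 ≤ d) (k : ℕ) : ∃ N : ℕ,
    ((2 : ℝ) ^ k) ^ (d - 1) / d ≤ ((cells d k).filter fun c => ∑ i, c i = N).card := by
  have hmaps : ∀ c ∈ cells d k, (∑ i, c i) ∈ Finset.range (d * 2 ^ k) := by
    intro c hc
    rw [Finset.mem_range]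
    calc ∑ i, c i < ∑ _i : Fin d, 2 ^ k :=
          Finset.sum_lt_sum_of_nonempty ⟨⟨0, hd⟩, Finset.mem_univ _⟩ fun i _ => mem_cells.1 hc i
      _ = d * 2 ^ k := by simp
  have hne : (Finset.range (d * 2 ^ k)).Nonempty :=
    Finset.nonempty_range_iff.2 (by positivity)
  -- Pigeonhole: 2^{kd} cells share at most d·2^k index sums.
  obtain ⟨N, -, hcard⟩ := Finset.exists_le_card_fiber_of_nsmul_le_card_of_maps_to
    (b := ((2 : ℝ) ^ k) ^ (d - 1) / d) hmaps hne (by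
      rw [Finset.card_range, card_cells, nsmul_eq_mul]
      have hd0 : (d : ℝ) ≠ 0 := by positivity
      push_cast
      rw [← Nat.sub_add_cancel hd, pow_succ, Nat.add_sub_cancel, Nat.sub_add_cancel hd]
      field_simp
      exact le_rfl)
  exact ⟨N, hcard⟩

/-- Indicator functions of sets with boundary along an antidiagonal. -/
lemma pow_pred_le_lpEntropy {d : ℕ} (hd : 1 ≤ d) {p ε : ℝ} (hp : 1 ≤ p) (hε : 0 < ε) {k : ℕ}
    (hk : 8 * d * (2 : ℝ) ^ k * (2 * ε) ^ p ≤ 1) :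
    ((((2 : ℝ) ^ k) ^ (d - 1) / (4 * d) : ℝ) : EReal) ≤ lpEntropy (monotoneClass d) p ε := by
  have hd0 : (0 : ℝ) < d := by exact_mod_cast hd
  obtain ⟨N, hcard⟩ := exists_antidiagonal_card hd k
  set S := (cells d k).filter fun c => ∑ i, c i = N with hS
  -- The profiles `a` and `b` differ only at the sum `N`, so exactly the antidiagonal cells are
  -- free, with height 1.
  have h := le_lpEntropy_of_cells (d := d) (k := k) (a := fun j => if N < j then 1 else 0)
    (b := fun j => if N ≤ j then 1 else 0) (h := 1) hp one_pos hε
    (fun j => by split_ifs <;> norm_num)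
    (fun j => by split_ifs <;> first | omega | norm_num)
    (fun j => by split_ifs <;> first | omega | norm_num)
    (fun j _ => by split_ifs <;> norm_num)
    (S := S) (Finset.filter_subset _ _) (fun c hc => by
      rw [(Finset.mem_filter.1 hc).2]
      simp) (fun M hM => by
      have hM' : (S.card : ℝ) < 8 * M := by exact_mod_cast hM
      have hpos : (0 : ℝ) < (2 ^ k) ^ (d - 1) := by positivity
      have hk0 : (0 : ℝ) < 2 ^ k := by positivity
      rw [Real.one_rpow, one_mul]
      have h1 : ((2 : ℝ) ^ k) ^ (d - 1) < 8 * d * M := by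
        rw [div_le_iff₀ hd0] at hcard
        nlinarith
      have h2 : ((2 : ℝ) ^ k) ^ d = (2 ^ k) ^ (d - 1) * 2 ^ k := by
        rw [← pow_succ, Nat.sub_add_cancel hd]
      rw [inv_pow, ← div_eq_mul_inv, lt_div_iff₀ (by positivity), h2]
      have h3 : 0 ≤ (2 * ε) ^ p := by positivity
      calc (2 * ε) ^ p * ((2 ^ k) ^ (d - 1) * 2 ^ k)
          = (2 ^ k * (2 * ε) ^ p) * (2 ^ k) ^ (d - 1) := by ring
        _ < (2 ^ k * (2 * ε) ^ p) * (8 * d * M) := by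
            gcongr
        _ = (8 * d * 2 ^ k * (2 * ε) ^ p) * M := by ring
        _ ≤ 1 * M := by gcongr
        _ = M := one_mul _)
  refine le_trans ?_ h
  rw [EReal.coe_le_coe_iff]
  calc ((2 : ℝ) ^ k) ^ (d - 1) / (4 * d) = ((2 : ℝ) ^ k) ^ (d - 1) / d / 4 := by
        field_simp
    _ ≤ _ := by gcongr

/-- From a geometric sequence of scales to all scales. -/
lemma exists_lpEntropy_lower_bound {d : ℕ} {p A B a : ℝ} (hp : 1 ≤ p) (hA : 0 < A) (hB : 0 < B)
    (b : ℕ) (H : ∀ (ε : ℝ) (k : ℕ), 0 < ε → A * (2 : ℝ) ^ k * ε ^ a ≤ 1 →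
      ((B * ((2 : ℝ) ^ k) ^ b : ℝ) : EReal) ≤ lpEntropy (monotoneClass d) p ε) :
    ∃ c : ℝ, 0 < c ∧ ∀ ε : ℝ, 0 < ε → ε < 1 / 2 →
      ((c * ε ^ (-(b * a)) : ℝ) : EReal) ≤ lpEntropy (monotoneClass d) p ε := by
  refine ⟨min (B / (2 * A) ^ b) (1 / 4 / A ^ b), by positivity, fun ε hε hε2 => ?_⟩
  set y := 1 / ε ^ a with hy
  have hy0 : 0 < y := by positivity
  have hpow : ε ^ (-(b * a)) = y ^ b := by
    rw [hy, Real.rpow_neg hε.le, mul_comm, Real.rpow_mul hε.le, Real.rpow_natCast, one_div, inv_pow]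
  rw [hpow]
  -- If y < A not even k = 0 is admissible, and the trivial bound 1/4 is used; otherwise k is
  -- maximal with A·2^k ≤ y.
  rcases lt_or_ge y A with hyA | hyA
  · refine le_trans ?_ (quarter_le_lpEntropy hp hε hε2)
    rw [EReal.coe_le_coe_iff]
    calc _ ≤ 1 / 4 / A ^ b * A ^ b := by
          gcongr
          exact min_le_right _ _
      _ = 1 / 4 := by field_simp
  · obtain ⟨k, hk1, hk2⟩ := exists_nat_pow_near ((one_le_div hA).2 hyA) (one_lt_two (α := ℝ))
    refine le_trans ?_ (H ε k hε ?_)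
    · rw [EReal.coe_le_coe_iff]
      rw [pow_succ, div_lt_iff₀ hA] at hk2
      calc _ ≤ B / (2 * A) ^ b * (2 ^ k * (2 * A)) ^ b := by
            gcongr
            · exact min_le_left _ _
            · linarith
        _ = _ := by
            rw [mul_pow (2 ^ k : ℝ)]
            field_simp
    · rw [le_div_iff₀ hA] at hk1
      calc A * 2 ^ k * ε ^ a ≤ y * ε ^ a := by
            gcongr
            linarith
        _ = 1 := by
            rw [hy]
            field_simp

/-- The lower bound for the entropy given by perturbations of a linear function. -/
lemma exists_lpEntropy_ge_dim {d : ℕ} (hd : 1 ≤ d) {p : ℝ} (hp : 1 ≤ p) :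
    ∃ c : ℝ, 0 < c ∧ ∀ ε : ℝ, 0 < ε → ε < 1 / 2 →
      ((c * ε ^ (-(d : ℝ)) : ℝ) : EReal) ≤ lpEntropy (monotoneClass d) p ε := by
  have hd0 : (0 : ℝ) < d := by exact_mod_cast hd
  have h := exists_lpEntropy_lower_bound (d := d) (p := p) (A := 32 * d) (B := 1 / 4) (a := 1) hp
    (by positivity) (by norm_num) d fun ε k hε hk => by
      rw [Real.rpow_one] at hk
      rw [one_div_mul_eq_div]
      exact pow_le_lpEntropy hd hp hε hk
  simpa only [mul_one] using h

/-- The lower bound for the entropy given by indicator functions. -/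
lemma exists_lpEntropy_ge_boundary {d : ℕ} (hd : 1 ≤ d) {p : ℝ} (hp : 1 ≤ p) :
    ∃ c : ℝ, 0 < c ∧ ∀ ε : ℝ, 0 < ε → ε < 1 / 2 →
      ((c * ε ^ (-(((d : ℝ) - 1) * p)) : ℝ) : EReal) ≤ lpEntropy (monotoneClass d) p ε := by
  have hd0 : (0 : ℝ) < d := by exact_mod_cast hd
  have h := exists_lpEntropy_lower_bound (d := d) (p := p) (A := 8 * d * 2 ^ p) (B := 1 / (4 * d))
    (a := p) hp (by positivity) (by positivity) (d - 1) fun ε k hε hk => by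
      rw [one_div_mul_eq_div]
      refine pow_pred_le_lpEntropy hd hp hε (le_of_eq_of_le ?_ hk)
      rw [Real.mul_rpow two_pos.le hε.le]
      ring
  rwa [Nat.cast_sub hd, Nat.cast_one] at h

theorem theorem1p1 (d : ℕ) (hd : 1 ≤ d) (p : ℝ) (hp : 1 ≤ p) :
    ∃ c₁ c₂ : ℝ, 0 < c₁ ∧ 0 < c₂ ∧
      (((d : ℝ) - 1) * p ≠ d →
        ∀ ε : ℝ, 0 < ε → ε < 1 / 2 →
          ((c₁ * ε ^ (-(max (d : ℝ) (((d : ℝ) - 1) * p))) : ℝ) : EReal)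
              ≤ lpEntropy (monotoneClass d) p ε ∧
          lpEntropy (monotoneClass d) p ε ≤ lpBracketingEntropy (monotoneClass d) p ε ∧
          lpBracketingEntropy (monotoneClass d) p ε
              ≤ ((c₂ * ε ^ (-(max (d : ℝ) (((d : ℝ) - 1) * p))) : ℝ) : EReal)) ∧
      (((d : ℝ) - 1) * p = d →
        ∀ ε : ℝ, 0 < ε → ε < 1 / 2 →
          ((c₁ * ε ^ (-(d : ℝ)) : ℝ) : EReal) ≤ lpEntropy (monotoneClass d) p ε ∧
          lpEntropy (monotoneClass d) p ε ≤ lpBracketingEntropy (monotoneClass d) p ε ∧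
          lpBracketingEntropy (monotoneClass d) p ε
              ≤ ((c₂ * ε ^ (-(d : ℝ)) * (Real.log (1 / ε)) ^ (1 + (d : ℝ) / p) : ℝ) : EReal)) := by
  -- `d` and `p` decide the case before the constants are chosen, so the constants serve one case
  -- and the other is vacuous.
  by_cases hpd : ((d : ℝ) - 1) * p = d
  · obtain ⟨c₁, hc₁, h₁⟩ := exists_lpEntropy_ge_dim hd hp
    obtain ⟨c₂, hc₂, h₂⟩ := exists_lpBracketingEntropy_le_critical hd hp hpd
    exact ⟨c₁, c₂, hc₁, hc₂, fun h => absurd hpd h, fun _ ε hε hε2 =>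
      ⟨h₁ ε hε hε2, lpEntropy_le_lpBracketingEntropy _ _ _, h₂ ε hε hε2⟩⟩
  · obtain ⟨c₁, hc₁, h₁⟩ : ∃ c : ℝ, 0 < c ∧ ∀ ε : ℝ, 0 < ε → ε < 1 / 2 →
        ((c * ε ^ (-(max (d : ℝ) (((d : ℝ) - 1) * p))) : ℝ) : EReal) ≤
          lpEntropy (monotoneClass d) p ε := by
      rcases le_total (((d : ℝ) - 1) * p) d with h | h
      · rw [max_eq_left h]
        exact exists_lpEntropy_ge_dim hd hp
      · rw [max_eq_right h]
        exact exists_lpEntropy_ge_boundary hd hp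
    obtain ⟨c₂, hc₂, h₂⟩ := exists_lpBracketingEntropy_le hd hp hpd
    exact ⟨c₁, c₂, hc₁, hc₂, fun _ ε hε hε2 =>
      ⟨h₁ ε hε hε2, lpEntropy_le_lpBracketingEntropy _ _ _, h₂ ε hε hε2⟩, fun h => absurd h hpd⟩
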